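/- Let $N\ge 1$, let $\Omega\subset\mathbb R^N$ be a bounded domain (non-empty, open, connected; no regularity of $\partial\Omega$ is needed), and let $p>1$. Let $h:[0,\infty)\to[0,\infty)$ and $g:\Omega\times\mathbb R\to\mathbb R$ with $g(x,\cdot)$ integrable on bounded intervals for every $x\in\Omega$, and set $$H(t)=\int_0^t h(s)\,ds,\qquad G(x,t)=\int_0^t g(x,s)\,ds .$$ Assume: (H1) $h$ is continuous, bounded and non-decreasing. (H2) For all $u,v\in W^{1,p}_0(\Omega)$ the functions $G(x,u)$ and $g(x,u)v$ are integrable over $\Omega$, and the map $u\mapsto\int_\Omega G(x,u)\,dx$ is Fréchet differentiable on $W^{1,p}_0(\Omega)$, its derivative at $u$ being $v\mapsto\int_\Omega g(x,u)v\,dx$. (H3) For every $x\in\Omega$ the function $t\mapsto G(x,t^{1/p})$ is concave on $[0,\infty)$. Let $$I(u)=\frac1p\int_\Omega H(|\nabla u|^p)\,dx-\int_\Omega G(x,u)\,dx,\qquad u\in W^{1,p}_0(\Omega),$$ which is the energy functional of the problem $-\operatorname{div}\big(h(|\nabla u|^p)|\nabla u|^{p-2}\nabla u\big)=g(x,u)$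 in $\Omega$, $u=0$ on $\partial\Omega$. Let $A$ be the set of positive critical points of $I$, that is, of those $u\in W^{1,p}_0(\Omega)$ with $I'(u)=0$ (Fréchet derivative) and $u>0$ in $\Omega$, where $u>0$ means that $u>0$ almost everywhere and, if $u$ has a continuous representative on $\Omega$, that this representative is positive at every point of $\Omega$. Assume also: (H4) Every critical point $u\ge 0$ of $I$ belongs to $C(\overline\Omega)$, and for any $u,v\in A$ there is $\delta\ge1$ such that $\delta^{-1}v\le u\le\delta v$ in $\Omega$. If $A\neq\emptyset$, then: (i) $I$ is constant on $A$. (ii) If $h$ is strictly increasing on $[0,\infty)$, or if for every $x\in\Omega$ the function $t\mapsto G(x,t^{1/p})$ is strictly concave on $[0,\infty)$, then $A$ is a singleton. (iii) If $h>0$ on $(0,\infty)$, then there is $u_0\in A$ with $A\subset\{\alpha u_0:\alpha\in(0,\infty)\}$. (iv) Assume (H1)–(H3), but, instead of (H4), only that $A'\subset A$ is a non-empty set such that every $u\in A'$ belongs to $C(\overline\Omega)$ and for any $u,v\in A'$ there is $\delta\ge1$ with $\delta^{-1}v\le u\le\delta v$ in $\Omega$. Then (i)–(iii) hold with $A$ replaced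 by $A'$. -/

import Mathlib

open MeasureTheory Set
open scoped ContDiff Gradient

namespace GenPLaplacian

instance fact_one_le_ofReal (p : ℝ) [hp : Fact (1 < p)] : Fact (1 ≤ ENNReal.ofReal p) :=
  ⟨by simpa using hp.out.le⟩

/-- The pairs `(φ, ∇φ)` in `L^p(Ω; ℝ) × L^p(Ω; ℝ^N)` with `φ ∈ C_c^∞(Ω)`. -/
def testPairs (N : ℕ) (Ω : Set (EuclideanSpace ℝ (Fin N))) (p : ℝ) [Fact (1 < p)] :
    Submodule ℝ
      (Lp ℝ (ENNReal.ofReal p) (volume.restrict Ω) ×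
        Lp (EuclideanSpace ℝ (Fin N)) (ENNReal.ofReal p) (volume.restrict Ω)) where
  carrier := {w | ∃ φ : EuclideanSpace ℝ (Fin N) → ℝ,
    ContDiff ℝ ∞ φ ∧ HasCompactSupport φ ∧ tsupport φ ⊆ Ω ∧
      w.1 =ᵐ[volume.restrict Ω] φ ∧ w.2 =ᵐ[volume.restrict Ω] gradient φ}
  add_mem' := by
    rintro a b ⟨φ, hφ, hcφ, hsφ, hφ1, hφ2⟩ ⟨ψ, hψ, hcψ, hsψ, hψ1, hψ2⟩
    refine ⟨φ + ψ, hφ.add hψ, hcφ.add hcψ,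
      (tsupport_add φ ψ).trans (union_subset hsφ hsψ), ?_, ?_⟩
    · filter_upwards [Lp.coeFn_add a.1 b.1, hφ1, hψ1] with x h h1 h2
      exact h.trans (by simp [h1, h2])
    · filter_upwards [Lp.coeFn_add a.2 b.2, hφ2, hψ2] with x h h1 h2
      have e1 : DifferentiableAt ℝ φ x := (hφ.differentiable (by simp)) x
      have e2 : DifferentiableAt ℝ ψ x := (hψ.differentiable (by simp)) x
      exact h.trans (by simp [h1, h2, gradient, fderiv_add e1 e2])
  zero_mem' := by
    refine ⟨0, contDiff_const, HasCompactSupport.zero, by simp [tsupport], ?_, ?_⟩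
    · exact Lp.coeFn_zero _ _ _
    · filter_upwards [Lp.coeFn_zero (EuclideanSpace ℝ (Fin N)) (ENNReal.ofReal p)
        (volume.restrict Ω)] with x h
      exact h.trans (by simp [gradient])
  smul_mem' := by
    rintro c a ⟨φ, hφ, hcφ, hsφ, hφ1, hφ2⟩
    refine ⟨c • φ, hφ.const_smul c, hcφ.smul_left (f := fun _ => c),
      (tsupport_smul_subset_right (fun _ => c) φ).trans hsφ, ?_, ?_⟩
    · filter_upwards [Lp.coeFn_smul c a.1, hφ1] with x h h1
      exact h.trans (by simp [h1])
    · filter_upwards [Lp.coeFn_smul c a.2, hφ2] with x h h1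
      have e1 : DifferentiableAt ℝ φ x := (hφ.differentiable (by simp)) x
      exact h.trans (by simp [h1, gradient, fderiv_const_smul e1])

/-- The Sobolev space `W_0^{1,p}(Ω)`: the closure of `C_c^∞(Ω)` in the `W^{1,p}` norm.
A function `u` is stored together with its weak gradient as the pair `(u, ∇u)` (the second entry
is determined by the first, because weak gradients are unique and pass to `L^p` limits), and the
norm is `max (‖u‖_{L^p}) (‖∇u‖_{L^p})`, which is equivalent to the usual one. -/
noncomputable abbrev W0 (N : ℕ) (Ω : Set (EuclideanSpace ℝ (Fin N))) (p : ℝ) [Fact (1 < p)] :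
    Submodule ℝ
      (Lp ℝ (ENNReal.ofReal p) (volume.restrict Ω) ×
        Lp (EuclideanSpace ℝ (Fin N)) (ENNReal.ofReal p) (volume.restrict Ω)) :=
  (testPairs N Ω p).topologicalClosure

variable {N : ℕ} {Ω : Set (EuclideanSpace ℝ (Fin N))} {p : ℝ} [Fact (1 < p)]

/-- The function `u` underlying an element of `W_0^{1,p}(Ω)` (defined up to null sets of `Ω`). -/
noncomputable def val (u : W0 N Ω p) : EuclideanSpace ℝ (Fin N) → ℝ := u.1.1

/-- The weak gradient `∇u` of an element of `W_0^{1,p}(Ω)`. -/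
noncomputable def grad (u : W0 N Ω p) : EuclideanSpace ℝ (Fin N) → EuclideanSpace ℝ (Fin N) :=
  u.1.2

/-- `H(t) = ∫_0^t h(s) ds`. -/
noncomputable def primH (h : ℝ → ℝ) (t : ℝ) : ℝ := ∫ s in (0 : ℝ)..t, h s

/-- `G(x,t) = ∫_0^t g(x,s) ds`. -/
noncomputable def primG (g : EuclideanSpace ℝ (Fin N) → ℝ → ℝ) (x : EuclideanSpace ℝ (Fin N))
    (t : ℝ) : ℝ := ∫ s in (0 : ℝ)..t, g x s

/-- `I(u) = (1/p) ∫_Ω H(|∇u|^p) dx - ∫_Ω G(x,u) dx` on `W_0^{1,p}(Ω)`. -/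
noncomputable def energy (h : ℝ → ℝ) (g : EuclideanSpace ℝ (Fin N) → ℝ → ℝ) (u : W0 N Ω p) : ℝ :=
  (1 / p) * (∫ x in Ω, primH h (‖grad u x‖ ^ p)) - ∫ x in Ω, primG g x (val u x)

/-- (H1): `h : [0,∞) → [0,∞)` is continuous, bounded and non-decreasing. -/
structure CondH1 (h : ℝ → ℝ) : Prop where
  nonneg : ∀ s, 0 ≤ s → 0 ≤ h s
  continuousOn : ContinuousOn h (Ici 0)
  bounded : ∃ M : ℝ, ∀ s, 0 ≤ s → h s ≤ M
  monotoneOn : MonotoneOn h (Ici 0)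

/-- (H2): `u ↦ ∫_Ω G(x,u) dx` is well defined and Fréchet differentiable on `W_0^{1,p}(Ω)`, with
derivative `v ↦ ∫_Ω g(x,u) v dx` at `u`. -/
structure CondH2 (Ω : Set (EuclideanSpace ℝ (Fin N))) (p : ℝ) [Fact (1 < p)]
    (g : EuclideanSpace ℝ (Fin N) → ℝ → ℝ) : Prop where
  intervalIntegrable : ∀ x ∈ Ω, ∀ t : ℝ, IntervalIntegrable (g x) volume 0 t
  integrable_primG : ∀ u : W0 N Ω p, IntegrableOn (fun x => primG g x (val u x)) Ω
  integrable_mul : ∀ u v : W0 N Ω p, IntegrableOn (fun x => g x (val u x) * val v x) Ω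
  hasFDerivAt : ∀ u : W0 N Ω p, ∃ L : W0 N Ω p →L[ℝ] ℝ,
    (∀ v : W0 N Ω p, L v = ∫ x in Ω, g x (val u x) * val v x) ∧
      HasFDerivAt (fun w : W0 N Ω p => ∫ x in Ω, primG g x (val w x)) L u

/-- (H3): for every `x ∈ Ω`, the function `t ↦ G(x, t^{1/p})` is concave on `[0,∞)`. -/
def CondH3 (Ω : Set (EuclideanSpace ℝ (Fin N))) (p : ℝ)
    (g : EuclideanSpace ℝ (Fin N) → ℝ → ℝ) : Prop :=
  ∀ x ∈ Ω, ConcaveOn ℝ (Ici 0) (fun t : ℝ => primG g x (t ^ (1 / p)))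

/-- The strict form of (H3). -/
def StrictH3 (Ω : Set (EuclideanSpace ℝ (Fin N))) (p : ℝ)
    (g : EuclideanSpace ℝ (Fin N) → ℝ → ℝ) : Prop :=
  ∀ x ∈ Ω, StrictConcaveOn ℝ (Ici 0) (fun t : ℝ => primG g x (t ^ (1 / p)))

/-- `u` is a critical point of `I`: `I` is Fréchet differentiable at `u` and `I'(u) = 0`. -/
def IsCritical (h : ℝ → ℝ) (g : EuclideanSpace ℝ (Fin N) → ℝ → ℝ) (u : W0 N Ω p) : Prop :=
  HasFDerivAt (energy h g : W0 N Ω p → ℝ) (0 : W0 N Ω p →L[ℝ] ℝ) u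

/-- `u > 0` in `Ω`: almost everywhere and, if `u` has a continuous representative, at every point
of `Ω` for that representative. -/
def IsPositive (u : W0 N Ω p) : Prop :=
  (∀ᵐ x ∂(volume.restrict Ω), 0 < val u x) ∧
    ∀ f : EuclideanSpace ℝ (Fin N) → ℝ, ContinuousOn f Ω → val u =ᵐ[volume.restrict Ω] f →
      ∀ x ∈ Ω, 0 < f x

/-- `u ∈ C(closure Ω)`. -/
def IsContinuousUpToBoundary (u : W0 N Ω p) : Prop :=
  ∃ f : EuclideanSpace ℝ (Fin N) → ℝ,
    ContinuousOn f (closure Ω) ∧ val u =ᵐ[volume.restrict Ω] f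

/-- `δ⁻¹ v ≤ u ≤ δ v` in `Ω` for some `δ ≥ 1`. -/
def AreComparable (u v : W0 N Ω p) : Prop :=
  ∃ δ : ℝ, 1 ≤ δ ∧
    ∀ᵐ x ∂(volume.restrict Ω), δ⁻¹ * val v x ≤ val u x ∧ val u x ≤ δ * val v x

/-- The set `A` of positive critical points of `I`. -/
def posCrit (Ω : Set (EuclideanSpace ℝ (Fin N))) (p : ℝ) [Fact (1 < p)] (h : ℝ → ℝ)
    (g : EuclideanSpace ℝ (Fin N) → ℝ → ℝ) : Set (W0 N Ω p) :=
  {u | IsCritical h g u ∧ IsPositive u}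

/-- (H4): every critical point `u ≥ 0` of `I` is in `C(closure Ω)`, and any two positive critical
points are comparable. -/
structure CondH4 (Ω : Set (EuclideanSpace ℝ (Fin N))) (p : ℝ) [Fact (1 < p)] (h : ℝ → ℝ)
    (g : EuclideanSpace ℝ (Fin N) → ℝ → ℝ) : Prop where
  regular : ∀ u : W0 N Ω p, IsCritical h g u → (∀ᵐ x ∂(volume.restrict Ω), 0 ≤ val u x) →
    IsContinuousUpToBoundary u
  comparable : ∀ u ∈ posCrit Ω p h g, ∀ v ∈ posCrit Ω p h g, AreComparable u v

/-- (H4) assumed only for the elements of a set `A'` of positive critical points. -/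
structure CondH4On (A' : Set (W0 N Ω p)) : Prop where
  regular : ∀ u ∈ A', IsContinuousUpToBoundary u
  comparable : ∀ u ∈ A', ∀ v ∈ A', AreComparable u v

end GenPLaplacian

open GenPLaplacian

/-! Hidden convexity drives everything. For positive `u`, `v` consider the path `w_t = ((1-t) u^p +
t v^p)^{1/p}`. Its logarithmic gradient `∇w_t / w_t` is a convex combination of `∇u/u` and `∇v/v`,
with weights `(1-t) u^p / w_t^p` and `t v^p / w_t^p`. Convexity of `|·|^p` thus gives `|∇w_t|^p ≤
(1-t)|∇u|^p + t|∇v|^p` (`norm_pMeanGrad_rpow_le`). As `H` is convex and non-decreasing and `G(x,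
t^{1/p})` is concave, `I` is convex along the path (`energy_isPMean_le`).

If `v ≤ d u`, the path is Lipschitz at `t = 0` in `W_0^{1,p}` (`exists_norm_isPMean_sub_le`). At a
critical point `u` this yields `I(w_t) - I(u) = o(t)`, and convexity upgrades it to `I(u) ≤ I(v)`
(`IsCritical.energy_le`). Comparability allows the roles to be exchanged, which is (i).

The midpoint `w` also satisfies `w ≤ d u`, so `I(u) ≤ I(w)`, while convexity gives `I(w) ≤ I(u)`.
Both pointwise convexity inequalities are then equalities almost everywhere (`exists_midpoint_eq`).
Strict concavity of `G(x, t^{1/p})` gives `u = v` at once. If `h > 0` on `(0,∞)`, then `H` is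
strictly increasing and `∇u/u = ∇v/v`; hence `log u - log v` has zero weak gradient on the connected
set `Ω`, and `u`, `v` are proportional. If `h` is strictly increasing, then `H` is strictly convex,
so also `|∇u| = |∇v|`; together these give `∇u = ∇v`, and a Poincaré inequality gives `u = v`.

The analytic work is to place `w_t` in `W_0^{1,p}` and to handle the logarithms. Both use smooth
functions of `(u, v)` vanishing at the origin with bounded partial derivatives (`exists_W0_comp`),
followed by dominated convergence. -/

open Filter Topology

namespace GenPLaplacian

section

/-! ### Pointwise inequalities for `ℓ^q` means and their gradients -/

section Pointwise

variable {E : Type*} [NormedAddCommGroup E] [NormedSpace ℝ E]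

theorem norm_combo_rpow_le {q a b : ℝ} (hq : 1 ≤ q) (ha : 0 ≤ a) (hb : 0 ≤ b) (hab : a + b = 1)
    (x y : E) : ‖a • x + b • y‖ ^ q ≤ a * ‖x‖ ^ q + b * ‖y‖ ^ q := by
  have h1 : ‖a • x + b • y‖ ≤ a * ‖x‖ + b * ‖y‖ := by
    refine (norm_add_le _ _).trans (le_of_eq ?_)
    rw [norm_smul, norm_smul, Real.norm_of_nonneg ha, Real.norm_of_nonneg hb]
  refine (Real.rpow_le_rpow (norm_nonneg _) h1 (by linarith)).trans ?_
  simpa using (convexOn_rpow hq).2 (norm_nonneg x) (norm_nonneg y) ha hb hab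

/-- Strictness has two sources: strict convexity of balls when `‖x‖ = ‖y‖`, and strict convexity of
`s ↦ s ^ q` when the norms differ. -/
theorem eq_of_norm_combo_rpow_eq [StrictConvexSpace ℝ E] {q a b : ℝ} (hq : 1 < q) (ha : 0 < a)
    (hb : 0 < b) (hab : a + b = 1) {x y : E}
    (h : a * ‖x‖ ^ q + b * ‖y‖ ^ q ≤ ‖a • x + b • y‖ ^ q) : x = y := by
  by_contra hne
  have h1 : ‖a • x + b • y‖ ≤ a * ‖x‖ + b * ‖y‖ := by
    refine (norm_add_le _ _).trans (le_of_eq ?_)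
    rw [norm_smul, norm_smul, Real.norm_of_nonneg ha.le, Real.norm_of_nonneg hb.le]
  by_cases hn : ‖x‖ = ‖y‖
  · have h2 := norm_combo_lt_of_ne (le_refl ‖x‖) hn.ge hne ha hb hab
    have h3 := Real.rpow_lt_rpow (norm_nonneg _) h2 (by linarith : 0 < q)
    rw [← hn, ← add_mul, hab, one_mul] at h
    linarith
  · have h2 := (strictConvexOn_rpow hq).2 (norm_nonneg x) (norm_nonneg y) hn ha hb hab
    have h3 := Real.rpow_le_rpow (norm_nonneg _) h1 (by linarith : 0 ≤ q)
    simp only [smul_eq_mul] at h2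
    linarith

/-- The weighted `ℓ^q` mean of two numbers. -/
noncomputable def pMean (q t a b : ℝ) : ℝ := ((1 - t) * a ^ q + t * b ^ q) ^ (1 / q)

/-- The gradient of `pMean q t u v` in terms of the values `a`, `b` and the gradients `X`, `Y` of
`u` and `v`. -/
noncomputable def pMeanGrad (q t a b : ℝ) (X Y : E) : E :=
  (pMean q t a b) ^ (1 - q) • (((1 - t) * a ^ (q - 1)) • X + (t * b ^ (q - 1)) • Y)

theorem pMean_base_pos {q t a b : ℝ} (ha : 0 < a) (hb : 0 < b) (ht0 : 0 ≤ t) (ht1 : t ≤ 1) :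
    0 < (1 - t) * a ^ q + t * b ^ q := by
  have h1 := Real.rpow_pos_of_pos ha q
  have h2 := Real.rpow_pos_of_pos hb q
  rcases ht0.eq_or_lt with rfl | h
  · simpa using h1
  · have : 0 ≤ 1 - t := by linarith
    positivity

theorem pMean_pos {q t a b : ℝ} (ha : 0 < a) (hb : 0 < b) (ht0 : 0 ≤ t) (ht1 : t ≤ 1) :
    0 < pMean q t a b := Real.rpow_pos_of_pos (pMean_base_pos ha hb ht0 ht1) _

theorem pMean_rpow {q t a b : ℝ} (hq : 0 < q) (ha : 0 < a) (hb : 0 < b) (ht0 : 0 ≤ t)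
    (ht1 : t ≤ 1) : pMean q t a b ^ q = (1 - t) * a ^ q + t * b ^ q := by
  rw [pMean, ← Real.rpow_mul (pMean_base_pos ha hb ht0 ht1).le, one_div_mul_cancel hq.ne',
    Real.rpow_one]

/-- Factoring out the mean exhibits the combination of the logarithmic gradients `a⁻¹ • X` and `b⁻¹
• Y`; by `pMean_weights` it is a convex one. -/
theorem pMeanGrad_eq {q t a b : ℝ} (ha : 0 < a) (hb : 0 < b) (ht0 : 0 ≤ t)
    (ht1 : t ≤ 1) (X Y : E) :
    pMeanGrad q t a b X Y = pMean q t a b •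
      (((1 - t) * a ^ q / pMean q t a b ^ q) • (a⁻¹ • X) +
        (t * b ^ q / pMean q t a b ^ q) • (b⁻¹ • Y)) := by
  have hm := pMean_pos (q := q) ha hb ht0 ht1
  rw [pMeanGrad, smul_add, smul_add, smul_smul, smul_smul, smul_smul, smul_smul, smul_smul,
    smul_smul, Real.rpow_sub hm, Real.rpow_sub ha, Real.rpow_sub hb, Real.rpow_one, Real.rpow_one,
    Real.rpow_one]
  congr 2 <;> field_simp

theorem pMean_weights {q t a b : ℝ} (hq : 0 < q) (ha : 0 < a) (hb : 0 < b) (ht0 : 0 ≤ t)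
    (ht1 : t ≤ 1) :
    (1 - t) * a ^ q / pMean q t a b ^ q + t * b ^ q / pMean q t a b ^ q = 1 := by
  rw [← add_div, pMean_rpow hq ha hb ht0 ht1, div_self (pMean_base_pos ha hb ht0 ht1).ne']

theorem pMean_weights_combo {q t a b : ℝ} (ha : 0 < a) (hb : 0 < b) (ht0 : 0 ≤ t)
    (ht1 : t ≤ 1) (X Y : E) :
    pMean q t a b ^ q * ((1 - t) * a ^ q / pMean q t a b ^ q * ‖a⁻¹ • X‖ ^ q +
      t * b ^ q / pMean q t a b ^ q * ‖b⁻¹ • Y‖ ^ q) = (1 - t) * ‖X‖ ^ q + t * ‖Y‖ ^ q := by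
  have hm := Real.rpow_pos_of_pos (pMean_pos (q := q) ha hb ht0 ht1) q
  have h1 := Real.rpow_pos_of_pos ha q
  have h2 := Real.rpow_pos_of_pos hb q
  rw [norm_smul, norm_smul, Real.mul_rpow (norm_nonneg _) (norm_nonneg _),
    Real.mul_rpow (norm_nonneg _) (norm_nonneg _), norm_inv, norm_inv, Real.norm_of_nonneg ha.le,
    Real.norm_of_nonneg hb.le, Real.inv_rpow ha.le, Real.inv_rpow hb.le]
  field_simp

/-- Hidden convexity of the `q`-Dirichlet integrand along the path of `ℓ^q` means. -/
theorem norm_pMeanGrad_rpow_le {q t a b : ℝ} (hq : 1 < q) (ha : 0 < a) (hb : 0 < b)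
    (ht0 : 0 ≤ t) (ht1 : t ≤ 1) (X Y : E) :
    ‖pMeanGrad q t a b X Y‖ ^ q ≤ (1 - t) * ‖X‖ ^ q + t * ‖Y‖ ^ q := by
  have hm := pMean_pos (q := q) ha hb ht0 ht1
  have : 0 ≤ 1 - t := by linarith
  rw [pMeanGrad_eq ha hb ht0 ht1, norm_smul, Real.norm_of_nonneg hm.le,
    Real.mul_rpow hm.le (norm_nonneg _), ← pMean_weights_combo ha hb ht0 ht1 X Y]
  refine mul_le_mul_of_nonneg_left (norm_combo_rpow_le hq.le ?_ ?_
    (pMean_weights (by linarith) ha hb ht0 ht1) _ _) (by positivity) <;> positivity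

theorem smul_eq_of_norm_pMeanGrad_rpow_eq [StrictConvexSpace ℝ E] {q t a b : ℝ} (hq : 1 < q)
    (ha : 0 < a) (hb : 0 < b) (ht0 : 0 < t) (ht1 : t < 1) {X Y : E}
    (h : (1 - t) * ‖X‖ ^ q + t * ‖Y‖ ^ q ≤ ‖pMeanGrad q t a b X Y‖ ^ q) :
    a⁻¹ • X = b⁻¹ • Y := by
  have hm := pMean_pos (q := q) ha hb ht0.le ht1.le
  have : 0 < 1 - t := by linarith
  rw [pMeanGrad_eq ha hb ht0.le ht1.le, norm_smul, Real.norm_of_nonneg hm.le,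
    Real.mul_rpow hm.le (norm_nonneg _), ← pMean_weights_combo ha hb ht0.le ht1.le X Y] at h
  refine eq_of_norm_combo_rpow_eq hq ?_ ?_ (pMean_weights (by linarith) ha hb ht0.le ht1.le)
    (le_of_mul_le_mul_left h (by positivity)) <;> positivity

/-- Mean value theorem on an interval bounded away from `0`, where the derivative of the power is
bounded whatever the sign of `e`. -/
theorem exists_abs_rpow_sub_one_le (e D : ℝ) (hD : 0 ≤ D) :
    ∃ C : ℝ, 0 ≤ C ∧ ∀ s ∈ Icc (1 / 2 : ℝ) (1 + D), |s ^ e - 1| ≤ C * |s - 1| := by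
  have hpos : ∀ s ∈ Icc (1 / 2 : ℝ) (1 + D), s ≠ 0 := fun s hs => by
    have := hs.1; intro h; rw [h] at this; norm_num at this
  have hc : ContinuousOn (fun s : ℝ => e * s ^ (e - 1)) (Icc (1 / 2 : ℝ) (1 + D)) :=
    continuousOn_const.mul (continuousOn_id.rpow_const fun s hs => Or.inl (hpos s hs))
  obtain ⟨C, hC⟩ := isCompact_Icc.exists_bound_of_continuousOn hc
  have h1 : (1 : ℝ) ∈ Icc (1 / 2 : ℝ) (1 + D) := ⟨by norm_num, by linarith⟩
  refine ⟨C, (norm_nonneg _).trans (hC 1 h1), fun s hs => ?_⟩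
  have := (convex_Icc (1 / 2 : ℝ) (1 + D)).norm_image_sub_le_of_norm_hasDerivWithin_le
    (f := fun s : ℝ => s ^ e) (fun y hy =>
      (Real.hasDerivAt_rpow_const (Or.inl (hpos y hy))).hasDerivWithinAt) hC h1 hs
  simpa using this

/-- By homogeneity only the ratio `r = b / a ≤ d` matters. With `s = 1 - t + t r^q` the mean is
`s^{1/q} a` and its gradient is `s^{(1-q)/q} ((1-t) X + t r^{q-1} Y)`, while `|s - 1| ≤ t d^q`. No
lower bound on `r` is needed because `q > 1`. -/
theorem exists_pMean_lipschitz_zero {q d : ℝ} (hq : 1 < q) (hd : 1 ≤ d) :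
    ∃ C : ℝ, 0 ≤ C ∧ ∀ t a b : ℝ, 0 ≤ t → t ≤ 1 / 2 → 0 < a → 0 < b → b ≤ d * a →
      |pMean q t a b - a| ≤ C * t * a ∧
      ∀ X Y : E, ‖pMeanGrad q t a b X Y - X‖ ≤ C * t * (‖X‖ + ‖Y‖) := by
  set D := d ^ q with hD
  have hD1 : 1 ≤ D := Real.one_le_rpow hd (by linarith)
  obtain ⟨C₁, hC₁, h1⟩ := exists_abs_rpow_sub_one_le (1 / q) D (by linarith)
  obtain ⟨C₂, hC₂, h2⟩ := exists_abs_rpow_sub_one_le ((1 - q) / q) D (by linarith)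
  set K := 1 + C₂ * D with hK
  have hK1 : 1 ≤ K := by nlinarith
  -- `C₁ * D` serves the mean itself, `C₂ * D + K` the coefficient of `X`, and `K * d ^ (q - 1)`
  -- that of `Y`; `K` bounds the factor `s^{(1-q)/q}`.
  refine ⟨C₁ * D + C₂ * D + K * d ^ (q - 1) + K, by positivity, ?_⟩
  intro t a b ht0 ht ha hb hab
  set r := b / a with hr
  have hr0 : 0 < r := by positivity
  have hbr : b = r * a := by rw [hr]; field_simp
  have hrd : r ≤ d := by rw [hr, div_le_iff₀ ha]; exact hab
  have hrq : r ^ q ≤ D := Real.rpow_le_rpow hr0.le hrd (by linarith)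
  have hrq0 : 0 < r ^ q := Real.rpow_pos_of_pos hr0 _
  have hrq1 : r ^ (q - 1) ≤ d ^ (q - 1) := Real.rpow_le_rpow hr0.le hrd (by linarith)
  set s := (1 - t) + t * r ^ q with hs
  have hsI : s ∈ Icc (1 / 2 : ℝ) (1 + D) := ⟨by nlinarith, by nlinarith⟩
  have hs0 : 0 < s := by linarith [hsI.1]
  have hs1 : |s - 1| ≤ t * D := by
    have : s - 1 = t * (r ^ q - 1) := by rw [hs]; ring
    rw [this, abs_mul, abs_of_nonneg ht0]
    refine mul_le_mul_of_nonneg_left (abs_le.2 ⟨by linarith, by linarith⟩) ht0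
  have hmean : pMean q t a b = s ^ (1 / q) * a := by
    have : (1 - t) * a ^ q + t * b ^ q = s * a ^ q := by
      rw [hbr, Real.mul_rpow hr0.le ha.le]; ring
    rw [pMean, this, Real.mul_rpow hs0.le (by positivity), ← Real.rpow_mul ha.le,
      mul_one_div_cancel (by linarith : q ≠ 0), Real.rpow_one]
  constructor
  · have : pMean q t a b - a = (s ^ (1 / q) - 1) * a := by rw [hmean]; ring
    rw [this, abs_mul, abs_of_pos ha]
    refine mul_le_mul_of_nonneg_right ((h1 s hsI).trans ?_) ha.le
    have : C₁ * |s - 1| ≤ C₁ * (t * D) := mul_le_mul_of_nonneg_left hs1 hC₁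
    refine this.trans ?_
    have : 0 ≤ (C₂ * D + K * d ^ (q - 1) + K) * t := by positivity
    nlinarith
  · intro X Y
    set e := s ^ ((1 - q) / q) with he
    have hgrad : pMeanGrad q t a b X Y = (e * (1 - t)) • X + (e * (t * r ^ (q - 1))) • Y := by
      have h3 : (pMean q t a b) ^ (1 - q) = e * a ^ (1 - q) := by
        rw [hmean, Real.mul_rpow (by positivity) ha.le, ← Real.rpow_mul hs0.le]
        congr 2; field_simp
      have h4 : a ^ (1 - q) * a ^ (q - 1) = 1 := by
        rw [← Real.rpow_add ha]; simp
      rw [pMeanGrad, h3, smul_add, smul_smul, smul_smul, hbr, Real.mul_rpow hr0.le ha.le]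
      congr 2
      · calc _ = e * (1 - t) * (a ^ (1 - q) * a ^ (q - 1)) := by ring
          _ = _ := by rw [h4, mul_one]
      · calc _ = e * (t * r ^ (q - 1)) * (a ^ (1 - q) * a ^ (q - 1)) := by ring
          _ = _ := by rw [h4, mul_one]
    have he1 : |e - 1| ≤ C₂ * D * t := by
      refine (h2 s hsI).trans ?_
      have := mul_le_mul_of_nonneg_left hs1 hC₂
      linarith
    have he0 : 0 < e := Real.rpow_pos_of_pos hs0 _
    have heK : e ≤ K := by
      have := (abs_le.1 he1).2
      have h5 : C₂ * D * t ≤ C₂ * D * 1 :=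
        mul_le_mul_of_nonneg_left (by linarith) (by positivity)
      linarith
    have : pMeanGrad q t a b X Y - X
        = (e * (1 - t) - 1) • X + (e * (t * r ^ (q - 1))) • Y := by
      rw [hgrad, sub_smul, one_smul]; abel
    rw [this]
    refine (norm_add_le _ _).trans ?_
    rw [norm_smul, norm_smul, mul_add]
    refine add_le_add (mul_le_mul_of_nonneg_right ?_ (norm_nonneg _))
      (mul_le_mul_of_nonneg_right ?_ (norm_nonneg _))
    · have h6 : e * (1 - t) - 1 = (e - 1) - e * t := by ring
      rw [h6, Real.norm_eq_abs]
      refine (abs_sub _ _).trans ?_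
      rw [abs_of_nonneg (by positivity : 0 ≤ e * t)]
      have h7 : e * t ≤ K * t := mul_le_mul_of_nonneg_right heK ht0
      have : 0 ≤ (C₁ * D + K * d ^ (q - 1)) * t := by positivity
      nlinarith
    · rw [Real.norm_of_nonneg (by positivity)]
      have h7 : e * r ^ (q - 1) ≤ K * d ^ (q - 1) :=
        mul_le_mul heK hrq1 (by positivity) (by positivity)
      have h8 := mul_le_mul_of_nonneg_right h7 ht0
      have : 0 ≤ (C₁ * D + C₂ * D + K) * t := by positivity
      nlinarith

end Pointwise

/-! ### Smooth regularisations of the `ℓ^q` mean -/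

/-- The smooth approximation `(a² + c)^{q/2}` of `|a|^q`. -/
noncomputable def regPow (q c a : ℝ) : ℝ := (a ^ 2 + c) ^ (q / 2)

/-- A smooth approximation of `pMean q t`. -/
noncomputable def regMean (q t c : ℝ) (z : ℝ × ℝ) : ℝ :=
  ((1 - t) * regPow q c z.1 + t * regPow q c z.2) ^ (1 / q) - (c ^ (q / 2)) ^ (1 / q)

/-- The partial derivative of `regMean` with respect to the entry `a` of weight `s`. -/
noncomputable def regMeanPartial (q t c s a : ℝ) (z : ℝ × ℝ) : ℝ :=
  ((1 - t) * regPow q c z.1 + t * regPow q c z.2) ^ (1 / q - 1) *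
    (s * (a * (a ^ 2 + c) ^ (q / 2 - 1)))

theorem regPow_pos (q : ℝ) {c : ℝ} (hc : 0 < c) (a : ℝ) : 0 < regPow q c a :=
  Real.rpow_pos_of_pos (by positivity) _

theorem regMean_base_pos (q : ℝ) {t c : ℝ} (hc : 0 < c) (ht0 : 0 ≤ t) (ht1 : t ≤ 1) (z : ℝ × ℝ) :
    0 < (1 - t) * regPow q c z.1 + t * regPow q c z.2 := by
  have h1 := regPow_pos q hc z.1
  have h2 := regPow_pos q hc z.2
  rcases ht0.eq_or_lt with rfl | h
  · simpa using h1
  · have : 0 ≤ 1 - t := by linarith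
    positivity

theorem contDiff_regPow (q : ℝ) {c : ℝ} (hc : 0 < c) : ContDiff ℝ ∞ (regPow q c) := by
  unfold regPow
  exact ContDiff.rpow_const_of_ne (by fun_prop) (fun x => by positivity)

theorem contDiff_regMean (q : ℝ) {t c : ℝ} (hc : 0 < c) (ht0 : 0 ≤ t) (ht1 : t ≤ 1) :
    ContDiff ℝ ∞ (regMean q t c) := by
  unfold regMean
  refine ContDiff.sub (ContDiff.rpow_const_of_ne ?_
    (fun z => (regMean_base_pos q hc ht0 ht1 z).ne')) contDiff_const
  exact (contDiff_const.mul ((contDiff_regPow q hc).comp contDiff_fst)).add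
    (contDiff_const.mul ((contDiff_regPow q hc).comp contDiff_snd))

/-- The constant subtracted in `regMean` is there for this: composing with test functions must
preserve compact support in `Ω`. -/
theorem regMean_zero (q t c : ℝ) : regMean q t c 0 = 0 := by
  simp [regMean, regPow, ← add_mul]

theorem hasDerivAt_regPow (q : ℝ) {c : ℝ} (hc : 0 < c) (a : ℝ) :
    HasDerivAt (regPow q c) (q * (a * (a ^ 2 + c) ^ (q / 2 - 1))) a := by
  have h1 : HasDerivAt (fun a : ℝ => a ^ 2 + c) (2 * a) a := by
    simpa using (hasDerivAt_pow 2 a).add_const c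
  have h2 := h1.rpow_const (p := q / 2) (Or.inl (by positivity))
  exact h2.congr_deriv (by ring)

theorem hasFDerivAt_regMean {q t c : ℝ} (hq : 0 < q) (hc : 0 < c) (ht0 : 0 ≤ t) (ht1 : t ≤ 1)
    (z : ℝ × ℝ) :
    HasFDerivAt (regMean q t c)
      (regMeanPartial q t c (1 - t) z.1 z • ContinuousLinearMap.fst ℝ ℝ ℝ +
        regMeanPartial q t c t z.2 z • ContinuousLinearMap.snd ℝ ℝ ℝ) z := by
  have h1 : HasFDerivAt (fun z : ℝ × ℝ => regPow q c z.1)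
      ((q * (z.1 * (z.1 ^ 2 + c) ^ (q / 2 - 1))) • ContinuousLinearMap.fst ℝ ℝ ℝ) z :=
    (hasDerivAt_regPow q hc z.1).comp_hasFDerivAt z (hasFDerivAt_fst (𝕜 := ℝ))
  have h2 : HasFDerivAt (fun z : ℝ × ℝ => regPow q c z.2)
      ((q * (z.2 * (z.2 ^ 2 + c) ^ (q / 2 - 1))) • ContinuousLinearMap.snd ℝ ℝ ℝ) z :=
    (hasDerivAt_regPow q hc z.2).comp_hasFDerivAt z (hasFDerivAt_snd (𝕜 := ℝ))
  have h3 := ((h1.const_mul (1 - t)).add (h2.const_mul t))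
  have h4 := (h3.rpow_const (p := 1 / q)
    (Or.inl (regMean_base_pos q hc ht0 ht1 z).ne')).sub_const ((c ^ (q / 2)) ^ (1 / q))
  refine h4.congr_fderiv ?_
  simp only [regMeanPartial, Pi.add_apply]
  ext <;> simp <;> field_simp

/-- With `Q` the weighted sum of regularised powers, `|a| ≤ (a² + c)^{1/2}` and `s ≤ s^{1-1/q}`
bound the second factor by `Q^{1-1/q}`, which cancels the prefactor `Q^{1/q-1}`. The bound does not
depend on `c`, so it survives `c → 0`. -/
theorem abs_regMeanPartial_le {q t c s a : ℝ} {z : ℝ × ℝ} (hq : 1 < q) (hc : 0 < c)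
    (hs0 : 0 ≤ s) (hs1 : s ≤ 1)
    (hle : s * regPow q c a ≤ (1 - t) * regPow q c z.1 + t * regPow q c z.2)
    (hpos : 0 < (1 - t) * regPow q c z.1 + t * regPow q c z.2) :
    |regMeanPartial q t c s a z| ≤ 1 := by
  set Q := (1 - t) * regPow q c z.1 + t * regPow q c z.2 with hQ
  have hA : 0 < a ^ 2 + c := by positivity
  have h1 : |a * (a ^ 2 + c) ^ (q / 2 - 1)| ≤ regPow q c a ^ (1 - 1 / q) := by
    have h2 : |a| ≤ (a ^ 2 + c) ^ (1 / 2 : ℝ) := by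
      rw [← Real.sqrt_eq_rpow]; exact Real.abs_le_sqrt (by linarith)
    rw [abs_mul, abs_of_pos (Real.rpow_pos_of_pos hA _), regPow, ← Real.rpow_mul hA.le]
    refine (mul_le_mul_of_nonneg_right h2 (by positivity)).trans (le_of_eq ?_)
    rw [← Real.rpow_add hA]
    congr 1
    field_simp
    ring
  have h3 : s ≤ s ^ (1 - 1 / q) := by
    rcases hs0.eq_or_lt with rfl | h
    · positivity
    · have : (1 : ℝ) / q ≥ 0 := by positivity
      simpa using Real.rpow_le_rpow_of_exponent_ge h hs1 (by linarith : 1 - 1 / q ≤ 1)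
  have h4 : (0 : ℝ) ≤ 1 - 1 / q := by
    have : 1 / q ≤ 1 := by rw [div_le_one (by linarith)]; exact hq.le
    linarith
  have hP := (regPow_pos q hc a).le
  have h5 : |s * (a * (a ^ 2 + c) ^ (q / 2 - 1))| ≤ Q ^ (1 - 1 / q) := by
    rw [abs_mul, abs_of_nonneg hs0]
    calc _ ≤ s ^ (1 - 1 / q) * regPow q c a ^ (1 - 1 / q) := by gcongr
      _ = (s * regPow q c a) ^ (1 - 1 / q) := (Real.mul_rpow hs0 hP).symm
      _ ≤ _ := Real.rpow_le_rpow (by positivity) hle h4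
  rw [regMeanPartial, ← hQ, abs_mul, abs_of_pos (Real.rpow_pos_of_pos hpos _)]
  calc _ ≤ Q ^ (1 / q - 1) * Q ^ (1 - 1 / q) := by gcongr
    _ = 1 := by rw [← Real.rpow_add hpos]; simp

theorem regPow_tendsto {q a : ℝ} (hq : 0 < q) (ha : 0 < a) :
    Tendsto (fun c => regPow q c a) (𝓝 0) (𝓝 (a ^ q)) := by
  have h : Continuous fun c : ℝ => (a ^ 2 + c) ^ (q / 2) :=
    Continuous.rpow_const (by fun_prop) (fun _ => Or.inr (by positivity))
  have h1 := h.tendsto 0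
  have h2 : (a ^ 2 + 0) ^ (q / 2) = a ^ q := by
    rw [add_zero, ← Real.rpow_natCast, ← Real.rpow_mul ha.le]; congr 1; push_cast; ring
  rwa [h2] at h1

theorem regMean_tendsto {q t a b : ℝ} (hq : 0 < q) (ha : 0 < a) (hb : 0 < b) :
    Tendsto (fun c => regMean q t c (a, b)) (𝓝 0) (𝓝 (pMean q t a b)) := by
  have h1 : Tendsto (fun c : ℝ => (c ^ (q / 2)) ^ (1 / q)) (𝓝 0) (𝓝 0) := by
    have h : Continuous fun c : ℝ => (c ^ (q / 2)) ^ (1 / q) :=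
      Continuous.rpow_const (Continuous.rpow_const continuous_id (fun _ => Or.inr (by positivity)))
        (fun _ => Or.inr (by positivity))
    have := h.tendsto 0
    rwa [Real.zero_rpow (by positivity), Real.zero_rpow (by positivity)] at this
  have h2 := ((((regPow_tendsto hq ha).const_mul (1 - t)).add
    ((regPow_tendsto hq hb).const_mul t)).rpow_const
      (p := 1 / q) (Or.inr (by positivity))).sub h1
  rwa [sub_zero] at h2

theorem regMeanPartial_tendsto {q t a b s d : ℝ} (hq : 0 < q) (ha : 0 < a) (hb : 0 < b)
    (hd : 0 < d) (ht0 : 0 ≤ t) (ht1 : t ≤ 1) :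
    Tendsto (fun c => regMeanPartial q t c s d (a, b)) (𝓝 0)
      (𝓝 (pMean q t a b ^ (1 - q) * (s * d ^ (q - 1)))) := by
  have hpos := pMean_base_pos (q := q) ha hb ht0 ht1
  have h1 : Tendsto (fun c : ℝ => (d ^ 2 + c) ^ (q / 2 - 1)) (𝓝 0)
      (𝓝 ((d ^ 2 + 0) ^ (q / 2 - 1))) := by
    have : Tendsto (fun c : ℝ => d ^ 2 + c) (𝓝 0) (𝓝 (d ^ 2 + 0)) :=
      tendsto_const_nhds.add tendsto_id
    exact this.rpow_const (Or.inl (by positivity))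
  have h2 : d * (d ^ 2 + 0) ^ (q / 2 - 1) = d ^ (q - 1) := by
    rw [add_zero, ← Real.rpow_natCast, ← Real.rpow_mul hd.le]
    nth_rw 1 [← Real.rpow_one d]
    rw [← Real.rpow_add hd]; congr 1; push_cast; ring
  have h3 : pMean q t a b ^ (1 - q) = ((1 - t) * a ^ q + t * b ^ q) ^ (1 / q - 1) := by
    rw [pMean, ← Real.rpow_mul hpos.le]; congr 1; field_simp
  rw [h3, ← h2]
  exact ((((regPow_tendsto hq ha).const_mul (1 - t)).add
    ((regPow_tendsto hq hb).const_mul t)).rpow_const (Or.inl hpos.ne')).mul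
      ((h1.const_mul d).const_mul s)

end

section

/-! ### Convergence in `L^q` -/

section LpLimits

variable {α E : Type*} [MeasurableSpace α] {μ : Measure α} [NormedAddCommGroup E]

theorem tendsto_eLpNorm_sub_of_dominated {q : ENNReal} (hq0 : q ≠ 0) (hqt : q ≠ ⊤)
    {f : ℕ → α → E} {g : α → E} {k : α → ℝ} (hf : ∀ n, AEStronglyMeasurable (f n) μ)
    (hk : MemLp k q μ) (hb : ∀ n, ∀ᵐ x ∂μ, ‖f n x‖ ≤ k x)
    (hlim : ∀ᵐ x ∂μ, Tendsto (fun n => f n x) atTop (𝓝 (g x))) :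
    Tendsto (fun n => eLpNorm (f n - g) q μ) atTop (𝓝 0) := by
  have hg : AEStronglyMeasurable g μ := aestronglyMeasurable_of_tendsto_ae atTop hf hlim
  have hr : 0 < q.toReal := ENNReal.toReal_pos hq0 hqt
  have hball : ∀ᵐ x ∂μ, ∀ n, ‖f n x‖ ≤ k x := ae_all_iff.2 hb
  have key : Tendsto (fun n => ∫⁻ x, ‖(f n - g) x‖ₑ ^ q.toReal ∂μ) atTop (𝓝 0) := by
    have h0 : (∫⁻ _, (0 : ENNReal) ∂μ) = 0 := by simp
    rw [← h0]
    refine tendsto_lintegral_of_dominated_convergence' (fun x => ‖2 * k x‖ₑ ^ q.toReal)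
      (fun n => ((hf n).sub hg).enorm.pow_const _) (fun n => ?_) ?_ ?_
    · filter_upwards [hball, hlim] with x hx hl
      refine ENNReal.rpow_le_rpow ?_ hr.le
      have h1 : ‖g x‖ ≤ k x := le_of_tendsto' hl.norm hx
      rw [← ofReal_norm, ← ofReal_norm]
      refine ENNReal.ofReal_le_ofReal ?_
      refine (norm_sub_le _ _).trans ?_
      rw [Real.norm_of_nonneg (by linarith [norm_nonneg (g x)])]
      linarith [hx n]
    · have h2 := hk.const_mul 2
      exact (lintegral_rpow_enorm_lt_top_of_eLpNorm_lt_top hq0 hqt h2.2).ne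
    · filter_upwards [hlim] with x hl
      have h3 : Tendsto (fun n => ‖f n x - g x‖ₑ ^ q.toReal) atTop (𝓝 (‖g x - g x‖ₑ ^ q.toReal)) :=
        ((hl.sub_const (g x)).enorm).ennrpow_const _
      simpa [ENNReal.zero_rpow_of_pos hr] using h3
  have h4 := key.ennrpow_const (1 / q.toReal)
  rw [ENNReal.zero_rpow_of_pos (by positivity)] at h4
  simpa [eLpNorm_eq_lintegral_rpow_enorm_toReal hq0 hqt] using h4

/-- Split `k_n X_n - k' X'` as `k_n (X_n - X') + (k_n - k') X'`. The uniform bound on `k_n` controls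
the first term; dominated convergence with majorant `C ‖X'‖` controls the part with `X'` fixed. -/
theorem tendsto_eLpNorm_smul_sub [NormedSpace ℝ E] {q : ENNReal} (hq1 : 1 ≤ q) (hqt : q ≠ ⊤)
    {k : ℕ → α → ℝ} {k' : α → ℝ} {X : ℕ → α → E} {X' : α → E} {C : ℝ}
    (hk : ∀ n, AEStronglyMeasurable (k n) μ) (hb : ∀ n x, |k n x| ≤ C)
    (hlim : ∀ᵐ x ∂μ, Tendsto (fun n => k n x) atTop (𝓝 (k' x)))
    (hX : ∀ n, AEStronglyMeasurable (X n) μ) (hX' : MemLp X' q μ)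
    (hXl : Tendsto (fun n => eLpNorm (X n - X') q μ) atTop (𝓝 0)) :
    Tendsto (fun n => eLpNorm ((fun x => k n x • X n x) - fun x => k' x • X' x) q μ) atTop
      (𝓝 0) := by
  have hq0 : q ≠ 0 := (zero_lt_one.trans_le hq1).ne'
  have hk' : AEStronglyMeasurable k' μ := aestronglyMeasurable_of_tendsto_ae atTop hk hlim
  have h1 : Tendsto (fun n => eLpNorm ((fun x => k n x • X' x) - fun x => k' x • X' x) q μ) atTop
      (𝓝 0) := by
    refine tendsto_eLpNorm_sub_of_dominated hq0 hqt (k := fun x => C * ‖X' x‖)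
      (fun n => (hk n).smul hX'.1) (hX'.norm.const_mul C) (fun n => ?_) ?_
    · refine Eventually.of_forall fun x => ?_
      rw [norm_smul]
      exact mul_le_mul_of_nonneg_right (hb n x) (norm_nonneg _)
    · filter_upwards [hlim] with x hx using hx.smul_const _
  have h2 : ∀ n, eLpNorm (fun x => k n x • (X n x - X' x)) q μ
      ≤ ENNReal.ofReal C * eLpNorm (X n - X') q μ := fun n =>
    eLpNorm_le_mul_eLpNorm_of_ae_le_mul (Eventually.of_forall fun x => by
      rw [norm_smul]
      exact mul_le_mul_of_nonneg_right (hb n x) (norm_nonneg _)) q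
  have h3 : Tendsto (fun n => ENNReal.ofReal C * eLpNorm (X n - X') q μ
      + eLpNorm ((fun x => k n x • X' x) - fun x => k' x • X' x) q μ) atTop (𝓝 0) := by
    have := (ENNReal.Tendsto.const_mul hXl (Or.inr (ENNReal.ofReal_ne_top (r := C)))).add h1
    simpa using this
  refine tendsto_of_tendsto_of_tendsto_of_le_of_le tendsto_const_nhds h3 (fun _ => zero_le)
    fun n => ?_
  have h4 : ((fun x => k n x • X n x) - fun x => k' x • X' x)
      = (fun x => k n x • (X n x - X' x)) + ((fun x => k n x • X' x) - fun x => k' x • X' x) := by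
    ext x; simp [smul_sub]
  rw [h4]
  refine (eLpNorm_add_le ?_ ?_ hq1).trans (add_le_add (h2 n) le_rfl)
  · exact (hk n).smul ((hX n).sub hX'.1)
  · exact ((hk n).smul hX'.1).sub (hk'.smul hX'.1)

theorem tendsto_eLpNorm_one [IsFiniteMeasure μ] {q : ENNReal} (hq1 : 1 ≤ q)
    {f : ℕ → α → E} {g : α → E} (hf : ∀ n, AEStronglyMeasurable (f n) μ)
    (hg : AEStronglyMeasurable g μ)
    (h : Tendsto (fun n => eLpNorm (f n - g) q μ) atTop (𝓝 0)) :
    Tendsto (fun n => eLpNorm (f n - g) 1 μ) atTop (𝓝 0) := by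
  have h1 : Tendsto (fun n => eLpNorm (f n - g) q μ *
      μ univ ^ (1 / (1 : ENNReal).toReal - 1 / q.toReal)) atTop (𝓝 0) := by
    have := ENNReal.Tendsto.mul_const (b := μ univ ^ (1 / (1 : ENNReal).toReal - 1 / q.toReal))
      h (Or.inr ?_)
    · simpa using this
    · refine (ENNReal.rpow_lt_top_of_nonneg ?_ (measure_ne_top μ _)).ne
      rcases eq_or_ne q ⊤ with rfl | hq
      · simp
      · have : 1 ≤ q.toReal := by
          rw [← ENNReal.toReal_one]; exact ENNReal.toReal_mono hq hq1
        have h2 : 1 / q.toReal ≤ 1 := by rw [div_le_one (by linarith)]; exact this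
        simp at h2 ⊢; exact h2
  exact tendsto_of_tendsto_of_tendsto_of_le_of_le tendsto_const_nhds h1 (fun _ => zero_le)
    fun n => eLpNorm_le_eLpNorm_mul_rpow_measure_univ hq1 ((hf n).sub hg)

theorem tendsto_integral_mul_of_tendsto_eLpNorm_one {f : ℕ → α → ℝ} {g k : α → ℝ} {C : ℝ}
    (hf : ∀ n, Integrable (f n) μ) (hg : Integrable g μ) (hk : AEStronglyMeasurable k μ)
    (hb : ∀ x, |k x| ≤ C) (h : Tendsto (fun n => eLpNorm (f n - g) 1 μ) atTop (𝓝 0)) :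
    Tendsto (fun n => ∫ x, f n x * k x ∂μ) atTop (𝓝 (∫ x, g x * k x ∂μ)) := by
  have hint : ∀ f : α → ℝ, Integrable f μ → Integrable (fun x => f x * k x) μ := fun f hf =>
    hf.mul_bdd hk (Eventually.of_forall fun x => hb x)
  refine tendsto_integral_of_L1' _ (hint g hg).1 (Eventually.of_forall fun n => hint _ (hf n)) ?_
  have h1 : Tendsto (fun n => ENNReal.ofReal C * eLpNorm (f n - g) 1 μ) atTop (𝓝 0) := by
    simpa using ENNReal.Tendsto.const_mul h (Or.inr (ENNReal.ofReal_ne_top (r := C)))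
  refine tendsto_of_tendsto_of_tendsto_of_le_of_le tendsto_const_nhds h1 (fun _ => zero_le)
    fun n => eLpNorm_le_mul_eLpNorm_of_ae_le_mul (Eventually.of_forall fun x => ?_) 1
  have : f n x * k x - g x * k x = k x * (f n x - g x) := by ring
  simp only [Pi.sub_apply]
  rw [this, norm_mul]
  exact mul_le_mul_of_nonneg_right (hb x) (norm_nonneg _)

end LpLimits

/-! ### Test functions and limits in `W_0^{1,p}(Ω)` -/

section Approximation

variable {N : ℕ} {Ω : Set (EuclideanSpace ℝ (Fin N))} {p : ℝ}

/-- `φ ∈ C_c^∞(Ω)`. -/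
def IsTest (Ω : Set (EuclideanSpace ℝ (Fin N))) (φ : EuclideanSpace ℝ (Fin N) → ℝ) : Prop :=
  ContDiff ℝ ∞ φ ∧ HasCompactSupport φ ∧ tsupport φ ⊆ Ω

theorem IsTest.differentiable {φ : EuclideanSpace ℝ (Fin N) → ℝ} (h : IsTest Ω φ) :
    Differentiable ℝ φ := h.1.differentiable (by simp)

theorem IsTest.continuous_fderiv {φ : EuclideanSpace ℝ (Fin N) → ℝ} (h : IsTest Ω φ) :
    Continuous (fderiv ℝ φ) := h.1.continuous_fderiv (by simp)

theorem inner_gradient {φ : EuclideanSpace ℝ (Fin N) → ℝ} (x e : EuclideanSpace ℝ (Fin N)) :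
    inner ℝ (gradient φ x) e = fderiv ℝ φ x e := by
  simp [gradient]

theorem norm_gradient {φ : EuclideanSpace ℝ (Fin N) → ℝ} (x : EuclideanSpace ℝ (Fin N)) :
    ‖gradient φ x‖ = ‖fderiv ℝ φ x‖ := by
  simp [gradient]

theorem IsTest.continuous_gradient {φ : EuclideanSpace ℝ (Fin N) → ℝ} (h : IsTest Ω φ) :
    Continuous (gradient φ) :=
  (InnerProductSpace.toDual ℝ (EuclideanSpace ℝ (Fin N))).symm.continuous.comp h.continuous_fderiv

theorem IsTest.hasCompactSupport_gradient {φ : EuclideanSpace ℝ (Fin N) → ℝ} (h : IsTest Ω φ) :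
    HasCompactSupport (gradient φ) :=
  (h.2.1.fderiv ℝ).comp_left (g := (InnerProductSpace.toDual ℝ (EuclideanSpace ℝ (Fin N))).symm)
    (map_zero _)

theorem IsTest.memLp {φ : EuclideanSpace ℝ (Fin N) → ℝ} (h : IsTest Ω φ) (q : ENNReal) :
    MemLp φ q (volume.restrict Ω) :=
  h.1.continuous.memLp_of_hasCompactSupport h.2.1

theorem IsTest.memLp_gradient {φ : EuclideanSpace ℝ (Fin N) → ℝ} (h : IsTest Ω φ) (q : ENNReal) :
    MemLp (gradient φ) q (volume.restrict Ω) :=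
  h.continuous_gradient.memLp_of_hasCompactSupport h.hasCompactSupport_gradient

variable [hp : Fact (1 < p)]

theorem one_le_ofReal : (1 : ENNReal) ≤ ENNReal.ofReal p := (fact_one_le_ofReal p).out

theorem memLp_val (u : W0 N Ω p) : MemLp (val u) (ENNReal.ofReal p) (volume.restrict Ω) :=
  Lp.memLp _

theorem memLp_grad (u : W0 N Ω p) : MemLp (grad u) (ENNReal.ofReal p) (volume.restrict Ω) :=
  Lp.memLp _

theorem W0.ext_ae {u v : W0 N Ω p} (h1 : val u =ᵐ[volume.restrict Ω] val v)
    (h2 : grad u =ᵐ[volume.restrict Ω] grad v) : u = v :=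
  Subtype.ext (Prod.ext (Lp.ext h1) (Lp.ext h2))

theorem val_sub (u v : W0 N Ω p) :
    val (u - v) =ᵐ[volume.restrict Ω] fun x => val u x - val v x := Lp.coeFn_sub _ _

theorem grad_sub (u v : W0 N Ω p) :
    grad (u - v) =ᵐ[volume.restrict Ω] fun x => grad u x - grad v x := Lp.coeFn_sub _ _

theorem val_smul (c : ℝ) (u : W0 N Ω p) :
    val (c • u) =ᵐ[volume.restrict Ω] fun x => c * val u x := Lp.coeFn_smul _ _

theorem IsTest.exists_W0 {φ : EuclideanSpace ℝ (Fin N) → ℝ} (h : IsTest Ω φ) :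
    ∃ w : W0 N Ω p, val w =ᵐ[volume.restrict Ω] φ ∧ grad w =ᵐ[volume.restrict Ω] gradient φ := by
  refine ⟨⟨((h.memLp _).toLp φ, (h.memLp_gradient _).toLp _), ?_⟩, ?_, ?_⟩
  · exact Submodule.le_topologicalClosure _
      ⟨φ, h.1, h.2.1, h.2.2, MemLp.coeFn_toLp (h.memLp _), MemLp.coeFn_toLp (h.memLp_gradient _)⟩
  · exact MemLp.coeFn_toLp (h.memLp _)
  · exact MemLp.coeFn_toLp (h.memLp_gradient _)

theorem exists_W0_of_tendsto {w : ℕ → W0 N Ω p} {f : EuclideanSpace ℝ (Fin N) → ℝ}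
    {X : EuclideanSpace ℝ (Fin N) → EuclideanSpace ℝ (Fin N)}
    (hf : MemLp f (ENNReal.ofReal p) (volume.restrict Ω))
    (hX : MemLp X (ENNReal.ofReal p) (volume.restrict Ω))
    (h1 : Tendsto (fun n => eLpNorm (val (w n) - f) (ENNReal.ofReal p) (volume.restrict Ω)) atTop
      (𝓝 0))
    (h2 : Tendsto (fun n => eLpNorm (grad (w n) - X) (ENNReal.ofReal p) (volume.restrict Ω)) atTop
      (𝓝 0)) :
    ∃ u : W0 N Ω p, val u =ᵐ[volume.restrict Ω] f ∧ grad u =ᵐ[volume.restrict Ω] X := by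
  refine ⟨⟨(hf.toLp f, hX.toLp X), ?_⟩, MemLp.coeFn_toLp hf, MemLp.coeFn_toLp hX⟩
  have t1 : Tendsto (fun n => (w n).1.1) atTop (𝓝 (hf.toLp f)) :=
    Lp.tendsto_Lp_of_tendsto_eLpNorm f hf h1
  have t2 : Tendsto (fun n => (w n).1.2) atTop (𝓝 (hX.toLp X)) :=
    Lp.tendsto_Lp_of_tendsto_eLpNorm X hX h2
  exact (Submodule.isClosed_topologicalClosure _).mem_of_tendsto (t1.prodMk_nhds t2)
    (Eventually.of_forall fun n => (w n).2)

/-- Convergence in `L^p` implies convergence in measure, hence almost everywhere along a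
subsequence. The pointwise limit is what lets nonlinear coefficients converge in the chain rule. -/
theorem exists_test_tendsto (u : W0 N Ω p) :
    ∃ φ : ℕ → EuclideanSpace ℝ (Fin N) → ℝ, (∀ n, IsTest Ω (φ n)) ∧
      Tendsto (fun n => eLpNorm (φ n - val u) (ENNReal.ofReal p) (volume.restrict Ω)) atTop
        (𝓝 0) ∧
      Tendsto (fun n => eLpNorm (gradient (φ n) - grad u) (ENNReal.ofReal p)
        (volume.restrict Ω)) atTop (𝓝 0) ∧
      ∀ᵐ x ∂(volume.restrict Ω), Tendsto (fun n => φ n x) atTop (𝓝 (val u x)) := by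
  have hmem : u.1 ∈ closure ((testPairs N Ω p : Submodule ℝ _) : Set (_ × _)) := u.2
  obtain ⟨w, hw, hlim⟩ := mem_closure_iff_seq_limit.1 hmem
  choose φ hφ1 hφ2 hφ3 hφ4 hφ5 using hw
  have t1 : Tendsto (fun n => eLpNorm (φ n - val u) (ENNReal.ofReal p) (volume.restrict Ω)) atTop
      (𝓝 0) := by
    have h := (Lp.tendsto_Lp_iff_tendsto_eLpNorm' _ _).1 ((continuous_fst.tendsto _).comp hlim)
    refine h.congr fun n => eLpNorm_congr_ae ?_
    exact (hφ4 n).sub EventuallyEq.rfl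
  have t2 : Tendsto (fun n => eLpNorm (gradient (φ n) - grad u) (ENNReal.ofReal p)
      (volume.restrict Ω)) atTop (𝓝 0) := by
    have h := (Lp.tendsto_Lp_iff_tendsto_eLpNorm' _ _).1 ((continuous_snd.tendsto _).comp hlim)
    refine h.congr fun n => eLpNorm_congr_ae ?_
    exact (hφ5 n).sub EventuallyEq.rfl
  have hne : ENNReal.ofReal p ≠ 0 := (zero_lt_one.trans_le one_le_ofReal).ne'
  obtain ⟨ns, hns, hae⟩ := (tendstoInMeasure_of_tendsto_eLpNorm hne
    (fun n => (hφ1 n).continuous.aestronglyMeasurable) (memLp_val u).1 t1).exists_seq_tendsto_ae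
  exact ⟨fun n => φ (ns n), fun n => ⟨hφ1 _, hφ2 _, hφ3 _⟩, t1.comp hns.tendsto_atTop,
    t2.comp hns.tendsto_atTop, hae⟩

theorem exists_W0_of_dominated {w : ℕ → W0 N Ω p} {f k K : EuclideanSpace ℝ (Fin N) → ℝ}
    {X : EuclideanSpace ℝ (Fin N) → EuclideanSpace ℝ (Fin N)}
    (hk : MemLp k (ENNReal.ofReal p) (volume.restrict Ω))
    (hK : MemLp K (ENNReal.ofReal p) (volume.restrict Ω))
    (hkb : ∀ n, ∀ᵐ x ∂(volume.restrict Ω), |val (w n) x| ≤ k x)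
    (hKb : ∀ n, ∀ᵐ x ∂(volume.restrict Ω), ‖grad (w n) x‖ ≤ K x)
    (h1 : ∀ᵐ x ∂(volume.restrict Ω), Tendsto (fun n => val (w n) x) atTop (𝓝 (f x)))
    (h2 : ∀ᵐ x ∂(volume.restrict Ω), Tendsto (fun n => grad (w n) x) atTop (𝓝 (X x))) :
    ∃ u : W0 N Ω p, val u =ᵐ[volume.restrict Ω] f ∧ grad u =ᵐ[volume.restrict Ω] X := by
  have hne : ENNReal.ofReal p ≠ 0 := (zero_lt_one.trans_le one_le_ofReal).ne'
  refine exists_W0_of_tendsto ?_ ?_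
    (tendsto_eLpNorm_sub_of_dominated hne ENNReal.ofReal_ne_top (fun n => (memLp_val (w n)).1) hk
      hkb h1)
    (tendsto_eLpNorm_sub_of_dominated hne ENNReal.ofReal_ne_top (fun n => (memLp_grad (w n)).1) hK
      hKb h2)
  · refine hk.mono (aestronglyMeasurable_of_tendsto_ae atTop (fun n => (memLp_val (w n)).1) h1) ?_
    filter_upwards [ae_all_iff.2 hkb, h1] with x hx hl
    exact (le_of_tendsto' hl.norm hx).trans (Real.le_norm_self _)
  · refine hK.mono (aestronglyMeasurable_of_tendsto_ae atTop (fun n => (memLp_grad (w n)).1) h2) ?_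
    filter_upwards [ae_all_iff.2 hKb, h2] with x hx hl
    exact (le_of_tendsto' hl.norm hx).trans (Real.le_norm_self _)

end Approximation

/-! ### Chain rule for smooth functions of two Sobolev functions -/

section ChainRule

theorem abs_sub_le_of_partials {F F₁ F₂ : ℝ × ℝ → ℝ} {C : ℝ}
    (hd : ∀ z, HasFDerivAt F
      (F₁ z • ContinuousLinearMap.fst ℝ ℝ ℝ + F₂ z • ContinuousLinearMap.snd ℝ ℝ ℝ) z)
    (hb₁ : ∀ z, |F₁ z| ≤ C) (hb₂ : ∀ z, |F₂ z| ≤ C) (z w : ℝ × ℝ) :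
    |F z - F w| ≤ 2 * C * (|z.1 - w.1| + |z.2 - w.2|) := by
  have hC : 0 ≤ C := (abs_nonneg _).trans (hb₁ 0)
  have hn : ∀ z, ‖F₁ z • ContinuousLinearMap.fst ℝ ℝ ℝ + F₂ z • ContinuousLinearMap.snd ℝ ℝ ℝ‖
      ≤ 2 * C := fun z => by
    refine (norm_add_le _ _).trans ?_
    rw [norm_smul, norm_smul, Real.norm_eq_abs, Real.norm_eq_abs]
    have e1 := ContinuousLinearMap.norm_fst_le ℝ ℝ ℝ
    have e2 := ContinuousLinearMap.norm_snd_le ℝ ℝ ℝ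
    nlinarith [hb₁ z, hb₂ z, abs_nonneg (F₁ z), abs_nonneg (F₂ z)]
  have := convex_univ.norm_image_sub_le_of_norm_hasFDerivWithin_le
    (fun x _ => (hd x).hasFDerivWithinAt) (fun x _ => hn x) (mem_univ w) (mem_univ z)
  refine this.trans (mul_le_mul_of_nonneg_left ?_ (by positivity))
  rw [Prod.norm_def]
  exact max_le (by simp [Real.norm_eq_abs]) (by simp [Real.norm_eq_abs])

variable {N : ℕ} {Ω : Set (EuclideanSpace ℝ (Fin N))} {p : ℝ} [hp : Fact (1 < p)]

/-- `F (φ n, ψ n)` is again a test function, since `F 0 = 0` confines its support to the union of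
the two supports. Its gradient combines `L^p`-convergent gradients with bounded coefficients
converging almost everywhere. -/
theorem exists_W0_comp {F F₁ F₂ : ℝ × ℝ → ℝ} {C : ℝ} (hF : ContDiff ℝ ∞ F) (h0 : F 0 = 0)
    (hd : ∀ z, HasFDerivAt F
      (F₁ z • ContinuousLinearMap.fst ℝ ℝ ℝ + F₂ z • ContinuousLinearMap.snd ℝ ℝ ℝ) z)
    (hb₁ : ∀ z, |F₁ z| ≤ C) (hb₂ : ∀ z, |F₂ z| ≤ C) (u v : W0 N Ω p) :
    ∃ w : W0 N Ω p, val w =ᵐ[volume.restrict Ω] (fun x => F (val u x, val v x)) ∧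
      grad w =ᵐ[volume.restrict Ω] fun x =>
        F₁ (val u x, val v x) • grad u x + F₂ (val u x, val v x) • grad v x := by
  have hq1 : 1 ≤ ENNReal.ofReal p := one_le_ofReal
  have hqt : ENNReal.ofReal p ≠ ⊤ := ENNReal.ofReal_ne_top
  have hC : 0 ≤ C := (abs_nonneg _).trans (hb₁ 0)
  obtain ⟨φ, hφ, hφ1, hφ2, hφ3⟩ := exists_test_tendsto u
  obtain ⟨ψ, hψ, hψ1, hψ2, hψ3⟩ := exists_test_tendsto v
  have hF₁c : Continuous F₁ := by
    have : F₁ = fun z => fderiv ℝ F z (1, 0) := by ext z; rw [(hd z).fderiv]; simp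
    rw [this]; exact (hF.continuous_fderiv (by simp)).clm_apply continuous_const
  have hF₂c : Continuous F₂ := by
    have : F₂ = fun z => fderiv ℝ F z (0, 1) := by ext z; rw [(hd z).fderiv]; simp
    rw [this]; exact (hF.continuous_fderiv (by simp)).clm_apply continuous_const
  have htest : ∀ n, IsTest Ω (fun x => F (φ n x, ψ n x)) := fun n => by
    have hsub : tsupport (fun x => F (φ n x, ψ n x)) ⊆ tsupport (φ n) ∪ tsupport (ψ n) := by
      refine closure_minimal (fun x hx => ?_)
        ((isClosed_tsupport _).union (isClosed_tsupport _))
      by_contra hcon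
      rw [mem_union, not_or] at hcon
      refine hx ?_
      beta_reduce
      rw [image_eq_zero_of_notMem_tsupport hcon.1, image_eq_zero_of_notMem_tsupport hcon.2]
      exact h0
    exact ⟨hF.comp ((hφ n).1.prodMk (hψ n).1),
      (IsCompact.union (hφ n).2.1 (hψ n).2.1).of_isClosed_subset (isClosed_tsupport _) hsub,
      hsub.trans (union_subset (hφ n).2.2 (hψ n).2.2)⟩
  have hgrad : ∀ n x, gradient (fun x => F (φ n x, ψ n x)) x
      = F₁ (φ n x, ψ n x) • gradient (φ n) x + F₂ (φ n x, ψ n x) • gradient (ψ n) x := by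
    intro n x
    have e1 := (hd (φ n x, ψ n x)).comp x
      (((hφ n).differentiable x).hasFDerivAt.prodMk ((hψ n).differentiable x).hasFDerivAt)
    have e2 : fderiv ℝ (fun x => F (φ n x, ψ n x)) x
        = F₁ (φ n x, ψ n x) • fderiv ℝ (φ n) x + F₂ (φ n x, ψ n x) • fderiv ℝ (ψ n) x := by
      rw [show (fun x => F (φ n x, ψ n x)) = F ∘ fun x => (φ n x, ψ n x) from rfl, e1.fderiv]
      ext y; simp
    simp only [gradient, e2, map_add, map_smulₛₗ]
    simp
  choose w hw1 hw2 using fun n => (htest n).exists_W0 (p := p)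
  have hlim : ∀ᵐ x ∂(volume.restrict Ω),
      Tendsto (fun n => (φ n x, ψ n x)) atTop (𝓝 (val u x, val v x)) := by
    filter_upwards [hφ3, hψ3] with x h1 h2 using h1.prodMk_nhds h2
  have hm : AEStronglyMeasurable (fun x => (val u x, val v x)) (volume.restrict Ω) :=
    (memLp_val u).1.prodMk (memLp_val v).1
  have hcm : ∀ n, AEStronglyMeasurable (fun x => (φ n x, ψ n x)) (volume.restrict Ω) := fun n =>
    ((hφ n).1.continuous.prodMk (hψ n).1.continuous).aestronglyMeasurable
  have key : ∀ (k : ℝ × ℝ → ℝ) (_ : Continuous k) (_ : ∀ z, |k z| ≤ C)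
      (θ : ℕ → EuclideanSpace ℝ (Fin N) → ℝ) (y : W0 N Ω p) (_ : ∀ n, IsTest Ω (θ n))
      (_ : Tendsto (fun n => eLpNorm (gradient (θ n) - grad y) (ENNReal.ofReal p)
        (volume.restrict Ω)) atTop (𝓝 0)),
      Tendsto (fun n => eLpNorm ((fun x => k (φ n x, ψ n x) • gradient (θ n) x)
        - fun x => k (val u x, val v x) • grad y x) (ENNReal.ofReal p) (volume.restrict Ω)) atTop
        (𝓝 0) := fun k hkc hkb θ y hθ hθl =>
    tendsto_eLpNorm_smul_sub hq1 hqt (fun n => hkc.comp_aestronglyMeasurable (hcm n))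
      (fun n x => hkb _) (by
        filter_upwards [hlim] with x hx using (hkc.tendsto _).comp hx)
      (fun n => (hθ n).continuous_gradient.aestronglyMeasurable) (memLp_grad y) hθl
  have hmemk : ∀ (k : ℝ × ℝ → ℝ) (_ : Continuous k) (_ : ∀ z, |k z| ≤ C) (y : W0 N Ω p),
      MemLp (fun x => k (val u x, val v x) • grad y x) (ENNReal.ofReal p) (volume.restrict Ω) :=
    fun k hkc hkb y => MemLp.of_le_mul (c := C) (memLp_grad y)
      ((hkc.comp_aestronglyMeasurable hm).smul (memLp_grad y).1)
      (Eventually.of_forall fun x => by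
        rw [norm_smul]; exact mul_le_mul_of_nonneg_right (hkb _) (norm_nonneg _))
  refine exists_W0_of_tendsto (w := w) ?_ ?_ ?_ ?_
  · refine (((memLp_val u).norm.add (memLp_val v).norm).const_mul (2 * C)).mono
      (hF.continuous.comp_aestronglyMeasurable hm) (Eventually.of_forall fun x => ?_)
    have := abs_sub_le_of_partials hd hb₁ hb₂ (val u x, val v x) 0
    rw [h0] at this
    refine le_trans ?_ (Real.le_norm_self _)
    simpa using this
  · exact (hmemk F₁ hF₁c hb₁ u).add (hmemk F₂ hF₂c hb₂ v)
  · have h3 : Tendsto (fun n => ENNReal.ofReal (2 * C) *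
        (eLpNorm (φ n - val u) (ENNReal.ofReal p) (volume.restrict Ω)
          + eLpNorm (ψ n - val v) (ENNReal.ofReal p) (volume.restrict Ω))) atTop (𝓝 0) := by
      simpa using ENNReal.Tendsto.const_mul (hφ1.add hψ1)
        (Or.inr (ENNReal.ofReal_ne_top (r := 2 * C)))
    refine tendsto_of_tendsto_of_tendsto_of_le_of_le tendsto_const_nhds h3 (fun _ => zero_le)
      fun n => ?_
    have e1 : eLpNorm (val (w n) - fun x => F (val u x, val v x)) (ENNReal.ofReal p)
        (volume.restrict Ω) ≤ ENNReal.ofReal (2 * C) *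
          eLpNorm ((fun x => ‖(φ n - val u) x‖) + fun x => ‖(ψ n - val v) x‖) (ENNReal.ofReal p)
            (volume.restrict Ω) := by
      refine eLpNorm_le_mul_eLpNorm_of_ae_le_mul ?_ _
      filter_upwards [hw1 n] with x hx
      simp only [Pi.sub_apply, Pi.add_apply, hx]
      have := abs_sub_le_of_partials hd hb₁ hb₂ (φ n x, ψ n x) (val u x, val v x)
      rw [Real.norm_of_nonneg (by positivity :
        0 ≤ ‖φ n x - val u x‖ + ‖ψ n x - val v x‖)]
      exact this
    refine e1.trans ?_
    gcongr
    refine (eLpNorm_add_le ?_ ?_ hq1).trans (by rw [eLpNorm_norm, eLpNorm_norm])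
    · exact ((hφ n).1.continuous.aestronglyMeasurable.sub (memLp_val u).1).norm
    · exact ((hψ n).1.continuous.aestronglyMeasurable.sub (memLp_val v).1).norm
  · have h3 := (key F₁ hF₁c hb₁ φ u hφ hφ2).add (key F₂ hF₂c hb₂ ψ v hψ hψ2)
    rw [add_zero] at h3
    refine tendsto_of_tendsto_of_tendsto_of_le_of_le tendsto_const_nhds h3 (fun _ => zero_le)
      fun n => ?_
    refine le_trans (le_of_eq (eLpNorm_congr_ae ?_)) (eLpNorm_add_le ?_ ?_ hq1)
    · filter_upwards [hw2 n] with x hx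
      simp only [Pi.sub_apply, Pi.add_apply, hx, hgrad]
      abel
    · exact ((hF₁c.comp_aestronglyMeasurable (hcm n)).smul
        (hφ n).continuous_gradient.aestronglyMeasurable).sub (hmemk F₁ hF₁c hb₁ u).1
    · exact ((hF₂c.comp_aestronglyMeasurable (hcm n)).smul
        (hψ n).continuous_gradient.aestronglyMeasurable).sub (hmemk F₂ hF₂c hb₂ v).1

end ChainRule

end

section

/-! ### Integration by parts, uniqueness of the gradient, Poincaré inequality -/

section Uniqueness

variable {N : ℕ} {Ω : Set (EuclideanSpace ℝ (Fin N))} {p : ℝ}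

theorem IsTest.apply_eq_zero {φ : EuclideanSpace ℝ (Fin N) → ℝ} (h : IsTest Ω φ)
    {x : EuclideanSpace ℝ (Fin N)} (hx : x ∉ Ω) : φ x = 0 :=
  image_eq_zero_of_notMem_tsupport fun h' => hx (h.2.2 h')

theorem IsTest.fderiv_eq_zero {φ : EuclideanSpace ℝ (Fin N) → ℝ} (h : IsTest Ω φ)
    {x : EuclideanSpace ℝ (Fin N)} (hx : x ∉ Ω) : fderiv ℝ φ x = 0 :=
  image_eq_zero_of_notMem_tsupport fun h' => hx (h.2.2 (tsupport_fderiv_subset ℝ h'))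

/-- `φ` and its derivative vanish off `Ω`, so both integrals extend to the whole space. There is no
boundary term, although `ψ` need not be supported in `Ω`. -/
theorem IsTest.setIntegral_mul_fderiv {φ : EuclideanSpace ℝ (Fin N) → ℝ} (h : IsTest Ω φ)
    {ψ : EuclideanSpace ℝ (Fin N) → ℝ} (hψ : IsTest univ ψ) (e : EuclideanSpace ℝ (Fin N)) :
    ∫ x in Ω, φ x * fderiv ℝ ψ x e = - ∫ x in Ω, inner ℝ (gradient φ x) e * ψ x := by
  have c1 : Continuous fun x => fderiv ℝ φ x e := h.continuous_fderiv.clm_apply continuous_const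
  have c2 : Continuous fun x => fderiv ℝ ψ x e := hψ.continuous_fderiv.clm_apply continuous_const
  rw [setIntegral_eq_integral_of_forall_compl_eq_zero
    (fun x hx => by rw [h.apply_eq_zero hx, zero_mul]),
    setIntegral_eq_integral_of_forall_compl_eq_zero
    (fun x hx => by rw [inner_gradient, h.fderiv_eq_zero hx]; simp)]
  simp_rw [inner_gradient]
  refine integral_mul_fderiv_eq_neg_fderiv_mul_of_integrable ?_ ?_ ?_
    (fun x _ => h.differentiable x) (fun x _ => hψ.differentiable x)
  · exact (c1.mul hψ.1.continuous).integrable_of_hasCompactSupport hψ.2.1.mul_left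
  · exact (h.1.continuous.mul c2).integrable_of_hasCompactSupport h.2.1.mul_right
  · exact (h.1.continuous.mul hψ.1.continuous).integrable_of_hasCompactSupport hψ.2.1.mul_left

variable [hp : Fact (1 < p)]

theorem finite_restrict (hb : Bornology.IsBounded Ω) :
    IsFiniteMeasure ((volume : Measure (EuclideanSpace ℝ (Fin N))).restrict Ω) :=
  ⟨by rw [Measure.restrict_apply_univ]; exact hb.measure_lt_top⟩

theorem integrable_val (hb : Bornology.IsBounded Ω) (u : W0 N Ω p) :
    Integrable (val u) (volume.restrict Ω) := by
  have := finite_restrict hb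
  exact (memLp_val u).integrable one_le_ofReal

theorem integrable_grad (hb : Bornology.IsBounded Ω) (u : W0 N Ω p) :
    Integrable (grad u) (volume.restrict Ω) := by
  have := finite_restrict hb
  exact (memLp_grad u).integrable one_le_ofReal

/-- Integration by parts in `W_0^{1,p}(Ω)` against smooth functions on the whole space. -/
theorem setIntegral_val_mul_fderiv (hb : Bornology.IsBounded Ω) (u : W0 N Ω p)
    {ψ : EuclideanSpace ℝ (Fin N) → ℝ} (hψ : IsTest univ ψ) (e : EuclideanSpace ℝ (Fin N)) :
    ∫ x in Ω, val u x * fderiv ℝ ψ x e = - ∫ x in Ω, inner ℝ (grad u x) e * ψ x := by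
  have := finite_restrict hb
  obtain ⟨φ, hφ, hφ1, hφ2, -⟩ := exists_test_tendsto u
  have c2 : Continuous fun x => fderiv ℝ ψ x e := hψ.continuous_fderiv.clm_apply continuous_const
  obtain ⟨C₁, hC₁⟩ := (hψ.2.1).exists_bound_of_continuous hψ.1.continuous
  obtain ⟨C₂, hC₂⟩ := (hψ.2.1.fderiv_apply ℝ e).exists_bound_of_continuous c2
  have t1 := tendsto_integral_mul_of_tendsto_eLpNorm_one
    (fun n => ((hφ n).memLp 1).integrable le_rfl) (integrable_val hb u)
    c2.aestronglyMeasurable hC₂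
    (tendsto_eLpNorm_one one_le_ofReal (fun n => ((hφ n).memLp 1).1) (memLp_val u).1 hφ1)
  have h1 : Tendsto (fun n => eLpNorm ((fun x => inner ℝ (gradient (φ n) x) e)
      - fun x => inner ℝ (grad u x) e) 1 (volume.restrict Ω)) atTop (𝓝 0) := by
    have h2 := tendsto_eLpNorm_one one_le_ofReal (fun n => ((hφ n).memLp_gradient 1).1)
      (memLp_grad u).1 hφ2
    have h3 : Tendsto (fun n => ENNReal.ofReal ‖e‖ * eLpNorm (gradient (φ n) - grad u) 1
        (volume.restrict Ω)) atTop (𝓝 0) := by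
      simpa using ENNReal.Tendsto.const_mul h2 (Or.inr (ENNReal.ofReal_ne_top (r := ‖e‖)))
    refine tendsto_of_tendsto_of_tendsto_of_le_of_le tendsto_const_nhds h3 (fun _ => zero_le)
      fun n => eLpNorm_le_mul_eLpNorm_of_ae_le_mul (Eventually.of_forall fun x => ?_) 1
    simp only [Pi.sub_apply]
    rw [← inner_sub_left, mul_comm]
    exact norm_inner_le_norm _ _
  have t2 := tendsto_integral_mul_of_tendsto_eLpNorm_one
    (fun n => (((hφ n).memLp_gradient 1).integrable le_rfl).inner_const e)
    ((integrable_grad hb u).inner_const e) hψ.1.continuous.aestronglyMeasurable hC₁ h1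
  refine tendsto_nhds_unique t1 (t2.neg.congr fun n => ?_)
  exact ((hφ n).setIntegral_mul_fderiv hψ e).symm

theorem grad_eq_zero_of_val_eq_zero (hb : Bornology.IsBounded Ω) {u : W0 N Ω p}
    (h : val u =ᵐ[volume.restrict Ω] 0) : grad u =ᵐ[volume.restrict Ω] 0 := by
  -- The fundamental lemma is applied to the restricted measure on the whole space, so `ψ` is not
  -- confined to `Ω`; hence the use of `IsTest univ` in the integration by parts.
  refine ae_eq_zero_of_integral_contDiff_smul_eq_zero (integrable_grad hb u).locallyIntegrable
    fun ψ hψ hψc => ?_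
  have hψt : IsTest univ ψ := ⟨hψ, hψc, subset_univ _⟩
  obtain ⟨C, hC⟩ := hψc.exists_bound_of_continuous hψ.continuous
  have hint : Integrable (fun x => ψ x • grad u x) (volume.restrict Ω) :=
    (integrable_grad hb u).bdd_smul C hψ.continuous.aestronglyMeasurable
      (Eventually.of_forall hC)
  refine ext_inner_left ℝ fun e => ?_
  rw [inner_zero_right, ← integral_inner hint]
  have h1 := setIntegral_val_mul_fderiv hb u hψt e
  rw [integral_congr_ae (g := fun _ => (0 : ℝ)) (by
    filter_upwards [h] with x hx; simp [hx])] at h1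
  simp only [integral_zero] at h1
  rw [← neg_eq_zero, h1]
  congr 1
  refine integral_congr_ae (Eventually.of_forall fun x => ?_)
  simp only [inner_smul_right]
  rw [real_inner_comm, mul_comm]

theorem W0.eq_of_val_eq (hb : Bornology.IsBounded Ω) {u v : W0 N Ω p}
    (h : val u =ᵐ[volume.restrict Ω] val v) : u = v := by
  refine W0.ext_ae h ?_
  have h1 : val (u - v) =ᵐ[volume.restrict Ω] 0 := by
    filter_upwards [val_sub u v, h] with x h1 h2
    simp [h1, h2]
  filter_upwards [grad_eq_zero_of_val_eq_zero hb h1, grad_sub u v] with x h1 h2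
  exact sub_eq_zero.1 (h2.symm.trans h1)

/-- From a point of the ball of radius `R`, a step of length `3R` in direction `e` ends at norm at
least `2R`, where `φ` vanishes. Integrate the derivative along that segment, then use Tonelli and
translation invariance. -/
theorem lintegral_enorm_le_of_support_subset_ball {φ : EuclideanSpace ℝ (Fin N) → ℝ}
    (hφ : ContDiff ℝ 1 φ) {R : ℝ} (hR : 0 < R)
    (hs : ∀ x, R < ‖x‖ → φ x = 0) {e : EuclideanSpace ℝ (Fin N)} (he : ‖e‖ = 1) :
    ∫⁻ x, ‖φ x‖ₑ ≤ ENNReal.ofReal (3 * R) * ∫⁻ x, ‖fderiv ℝ φ x‖ₑ := by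
  have hc : Continuous (fderiv ℝ φ) := hφ.continuous_fderiv (by simp)
  have hpt : ∀ x, ‖φ x‖ₑ ≤ ∫⁻ s in Ioc 0 (3 * R), ‖fderiv ℝ φ (x + s • e)‖ₑ := by
    intro x
    by_cases hx : R < ‖x‖
    · simp [hs x hx]
    have hend : φ (x + (3 * R) • e) = 0 := by
      refine hs _ ?_
      have h1 : ‖(3 * R) • e‖ = 3 * R := by
        rw [norm_smul, he, Real.norm_of_nonneg (by positivity), mul_one]
      have h2 := norm_sub_le (x + (3 * R) • e) x
      rw [add_sub_cancel_left, h1] at h2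
      linarith
    have hd : ∀ s : ℝ, HasDerivAt (fun s : ℝ => φ (x + s • e))
        (fderiv ℝ φ (x + s • e) e) s := fun s => by
      have h1 : HasDerivAt (fun s : ℝ => x + s • e) e s := by
        simpa using ((hasDerivAt_id s).smul_const e).const_add x
      exact ((hφ.differentiable (by simp)) (x + s • e)).hasFDerivAt.comp_hasDerivAt s h1
    have hc1 : Continuous fun s : ℝ => fderiv ℝ φ (x + s • e) e :=
      (hc.comp (by fun_prop)).clm_apply continuous_const
    have hint := intervalIntegral.integral_eq_sub_of_hasDerivAt (a := 0) (b := 3 * R)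
      (fun s _ => hd s) (hc1.intervalIntegrable _ _)
    rw [hend, zero_smul, add_zero, zero_sub, intervalIntegral.integral_of_le (by positivity)]
      at hint
    rw [← enorm_neg (φ x), ← hint]
    refine (enorm_integral_le_lintegral_enorm _).trans (lintegral_mono fun s => ?_)
    rw [← ofReal_norm, ← ofReal_norm]
    refine ENNReal.ofReal_le_ofReal ?_
    simpa [he] using (fderiv ℝ φ (x + s • e)).le_opNorm e
  calc ∫⁻ x, ‖φ x‖ₑ ≤ ∫⁻ x, ∫⁻ s in Ioc 0 (3 * R), ‖fderiv ℝ φ (x + s • e)‖ₑ :=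
        lintegral_mono hpt
    _ = ∫⁻ s in Ioc 0 (3 * R), ∫⁻ x, ‖fderiv ℝ φ (x + s • e)‖ₑ := by
        refine lintegral_lintegral_swap (Continuous.aemeasurable ?_)
        exact (hc.comp (by fun_prop : Continuous fun z : EuclideanSpace ℝ (Fin N) × ℝ =>
          z.1 + z.2 • e)).enorm
    _ = ∫⁻ _ in Ioc 0 (3 * R), ∫⁻ x, ‖fderiv ℝ φ x‖ₑ :=
        lintegral_congr fun s =>
          lintegral_add_right_eq_self (fun x => ‖fderiv ℝ φ x‖ₑ) (s • e)
    _ = _ := by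
        rw [setLIntegral_const, Real.volume_Ioc, sub_zero, mul_comm]

/-- Approximating test functions have gradients tending to `0` in `L^1`, so the `L^1` Poincaré
inequality sends the functions themselves to `0`. -/
theorem val_eq_zero_of_grad_eq_zero (hN : 1 ≤ N) (hb : Bornology.IsBounded Ω) {u : W0 N Ω p}
    (h : grad u =ᵐ[volume.restrict Ω] 0) : val u =ᵐ[volume.restrict Ω] 0 := by
  have := finite_restrict hb
  obtain ⟨φ, hφ, hφ1, hφ2, -⟩ := exists_test_tendsto u
  obtain ⟨R, hR, hΩR⟩ := hb.exists_pos_norm_le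
  have h1 := tendsto_eLpNorm_one one_le_ofReal (fun n => ((hφ n).memLp 1).1) (memLp_val u).1 hφ1
  have h2 := tendsto_eLpNorm_one one_le_ofReal (fun n => ((hφ n).memLp_gradient 1).1)
      (memLp_grad u).1 hφ2
  -- A unit direction exists because `N ≥ 1`.
  set e : EuclideanSpace ℝ (Fin N) := EuclideanSpace.single ⟨0, hN⟩ 1 with he
  have he1 : ‖e‖ = 1 := by simp [he]
  have h3 : ∀ n, eLpNorm (φ n) 1 (volume.restrict Ω) ≤ ENNReal.ofReal (3 * R) *
      eLpNorm (gradient (φ n) - grad u) 1 (volume.restrict Ω) := by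
    intro n
    have e1 : eLpNorm (gradient (φ n) - grad u) 1 (volume.restrict Ω)
        = eLpNorm (gradient (φ n)) 1 (volume.restrict Ω) := by
      refine eLpNorm_congr_ae ?_
      filter_upwards [h] with x hx
      simp [hx]
    have e2 : ∫⁻ x in Ω, ‖gradient (φ n) x‖ₑ = ∫⁻ x, ‖fderiv ℝ (φ n) x‖ₑ := by
      have : ∀ x, ‖gradient (φ n) x‖ₑ = ‖fderiv ℝ (φ n) x‖ₑ := fun x => by
        rw [← ofReal_norm, norm_gradient, ofReal_norm]
      simp_rw [this]
      refine setLIntegral_eq_of_support_subset fun x hx => ?_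
      by_contra hxΩ
      exact hx (by beta_reduce; rw [(hφ n).fderiv_eq_zero hxΩ, ← ofReal_norm, norm_zero, ENNReal.ofReal_zero])
    rw [e1, eLpNorm_one_eq_lintegral_enorm, eLpNorm_one_eq_lintegral_enorm, e2]
    refine (setLIntegral_le_lintegral _ _).trans
      (lintegral_enorm_le_of_support_subset_ball ((hφ n).1.of_le (by simp)) hR
        (fun x hx => (hφ n).apply_eq_zero fun hxΩ => ?_) he1)
    exact absurd (hΩR x hxΩ) (not_le.2 hx)
  have h4 : eLpNorm (val u) 1 (volume.restrict Ω) ≤ 0 := by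
    have t : Tendsto (fun n => eLpNorm (φ n - val u) 1 (volume.restrict Ω) +
        ENNReal.ofReal (3 * R) * eLpNorm (gradient (φ n) - grad u) 1 (volume.restrict Ω)) atTop
        (𝓝 0) := by
      simpa using h1.add
        (ENNReal.Tendsto.const_mul h2 (Or.inr (ENNReal.ofReal_ne_top (r := 3 * R))))
    refine ge_of_tendsto' t fun n => ?_
    have e1 : val u = φ n - (φ n - val u) := by abel
    calc eLpNorm (val u) 1 (volume.restrict Ω)
        = eLpNorm (φ n - (φ n - val u)) 1 (volume.restrict Ω) := by rw [← e1]
      _ ≤ eLpNorm (φ n) 1 (volume.restrict Ω) + eLpNorm (φ n - val u) 1 (volume.restrict Ω) :=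
          eLpNorm_sub_le ((hφ n).memLp 1).1 (((hφ n).memLp 1).1.sub (memLp_val u).1) le_rfl
      _ ≤ _ := by rw [add_comm]; gcongr; exact h3 n
  exact (eLpNorm_eq_zero_iff (memLp_val u).1 one_ne_zero).1 (le_antisymm h4 zero_le)

end Uniqueness

/-! ### Functions with vanishing weak gradient -/

section WeaklyConstant

variable {N : ℕ} {Ω : Set (EuclideanSpace ℝ (Fin N))}

theorem isTest_bump_translate {φ : ContDiffBump (0 : EuclideanSpace ℝ (Fin N))}
    {x : EuclideanSpace ℝ (Fin N)} (hx : Metric.closedBall x φ.rOut ⊆ Ω) :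
    IsTest Ω (fun y => φ.normed volume (x - y)) := by
  have hsub : tsupport (fun y => φ.normed volume (x - y)) ⊆ Metric.closedBall x φ.rOut := by
    refine closure_minimal (fun y hy => ?_) Metric.isClosed_closedBall
    have h1 : x - y ∈ Function.support (φ.normed volume) := hy
    rw [φ.support_normed_eq, mem_ball_zero_iff] at h1
    rw [Metric.mem_closedBall, dist_comm, dist_eq_norm]
    exact h1.le
  exact ⟨φ.contDiff_normed.comp (contDiff_const.sub contDiff_id),
    (isCompact_closedBall x φ.rOut).of_isClosed_subset (isClosed_tsupport _) hsub,
    hsub.trans hx⟩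

/-- A continuous function with vanishing weak gradient on a connected open set is constant. -/
theorem eqOn_const_of_weak_gradient_eq_zero (ho : IsOpen Ω) (hc : IsPreconnected Ω)
    {f : EuclideanSpace ℝ (Fin N) → ℝ} (hf : ContinuousOn f Ω) (hi : IntegrableOn f Ω)
    (h : ∀ ψ, IsTest Ω ψ → ∀ e, ∫ x in Ω, f x * fderiv ℝ ψ x e = 0) :
    ∀ x ∈ Ω, ∀ y ∈ Ω, f x = f y := by
  set F := Ω.indicator f with hF
  have hFi : Integrable F := (integrable_indicator_iff ho.measurableSet).2 hi
  -- Local constancy by mollification: the mollified functions are constant on the ball of radius `r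
  -- / 2` about `x₀`, and they converge pointwise to `f`.
  have hlocal : ∀ x₀ ∈ Ω, ∀ᶠ y in 𝓝 x₀, f y = f x₀ := by
    intro x₀ hx₀
    obtain ⟨r, hr, hball⟩ := Metric.isOpen_iff.1 ho x₀ hx₀
    filter_upwards [Metric.ball_mem_nhds x₀ (half_pos hr)] with y hy
    -- Outer radii at most `r / 2` keep every bump centred in `ball x₀ (r / 2)` supported inside
    -- `ball x₀ r ⊆ Ω`.
    let φ : ℕ → ContDiffBump (0 : EuclideanSpace ℝ (Fin N)) := fun n =>
      ⟨r / 2 / (2 * (n + 1)), r / 2 / (n + 1), by positivity, by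
        apply div_lt_div_of_pos_left <;> first | positivity | linarith⟩
    have hφr : ∀ n, (φ n).rOut ≤ r / 2 := fun n => by
      have : r / 2 / ((n : ℝ) + 1) ≤ r / 2 :=
        div_le_self (by positivity) (by linarith [(n.cast_nonneg : (0 : ℝ) ≤ n)])
      exact this
    have hφ0 : Tendsto (fun n => (φ n).rOut) atTop (𝓝 0) := by
      have : Tendsto (fun n : ℕ => r / 2 / ((n : ℝ) + 1)) atTop (𝓝 0) :=
        tendsto_const_nhds.div_atTop
          (tendsto_natCast_atTop_atTop.atTop_add tendsto_const_nhds)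
      exact this
    have hFc : ContinuousOn F Ω := hf.congr fun z hz => indicator_of_mem hz f
    have hlim : ∀ z ∈ Ω, Tendsto (fun n => convolution ((φ n).normed volume) F
        (ContinuousLinearMap.lsmul ℝ ℝ) volume z) atTop (𝓝 (f z)) := by
      intro z hz
      have h1 := ContDiffBump.convolution_tendsto_right (μ := volume) (g := fun _ => F)
        (k := fun _ => z) (x₀ := z) (z₀ := f z) hφ0
        (Eventually.of_forall fun _ => hFi.aestronglyMeasurable) ?_ tendsto_const_nhds
      · exact h1
      · have h2 : Tendsto F (𝓝 z) (𝓝 (F z)) := hFc.continuousAt (ho.mem_nhds hz)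
        rw [hF, indicator_of_mem hz] at h2
        exact h2.comp tendsto_snd
    have hconst : ∀ n, convolution ((φ n).normed volume) F
        (ContinuousLinearMap.lsmul ℝ ℝ) volume y = convolution ((φ n).normed volume) F
        (ContinuousLinearMap.lsmul ℝ ℝ) volume x₀ := by
      intro n
      have hd : ∀ z ∈ Metric.ball x₀ (r / 2), HasFDerivAt (convolution ((φ n).normed volume) F
          (ContinuousLinearMap.lsmul ℝ ℝ) volume)
          (0 : EuclideanSpace ℝ (Fin N) →L[ℝ] ℝ) z := by
        intro z hz
        have hzs : Metric.closedBall z (φ n).rOut ⊆ Ω := by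
          refine Subset.trans (fun w hw => ?_) hball
          rw [Metric.mem_closedBall] at hw
          rw [Metric.mem_ball] at hz ⊢
          have := dist_triangle w z x₀
          linarith [hφr n]
        -- The derivative of the convolution falls on the bump; up to sign it is the integral of `f`
        -- against the derivative of the test function `y ↦ (φ n).normed volume (z - y)`.
        have h1 := (φ n).hasCompactSupport_normed (μ := volume)
          |>.hasFDerivAt_convolution_right (ContinuousLinearMap.lsmul ℝ ℝ : ℝ →L[ℝ] ℝ →L[ℝ] ℝ).flip
          hFi.locallyIntegrable ((φ n).contDiff_normed (n := 1)) z
        rw [convolution_flip] at h1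
        refine h1.congr_fderiv ?_
        ext e
        rw [convolution_precompR_apply _ hFi.locallyIntegrable
          ((φ n).hasCompactSupport_normed.fderiv ℝ)
          (((φ n).contDiff_normed (n := 1)).continuous_fderiv (by simp)), convolution_def]
        have h2 := h _ (isTest_bump_translate hzs) e
        have h3 : ∀ x, fderiv ℝ (fun y => (φ n).normed volume (z - y)) x e
            = - fderiv ℝ ((φ n).normed volume) (z - x) e := fun x => by
          have h4 := ((((φ n).contDiff_normed (μ := volume) (n := 1)).differentiable (by simp))
            (z - x)).hasFDerivAt.comp x ((hasFDerivAt_id x).const_sub z)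
          have h5 : fderiv ℝ (fun y => (φ n).normed volume (z - y)) x = _ := h4.fderiv
          rw [h5]
          simp
        simp only [h3, mul_neg, integral_neg, neg_eq_zero] at h2
        rw [← integral_indicator ho.measurableSet] at h2
        refine Eq.trans (integral_congr_ae (Eventually.of_forall fun x => ?_)) h2
        by_cases hx : x ∈ Ω
        · simp [hF, hx, mul_comm]
        · simp [hF, hx]
      have := (convex_ball x₀ (r / 2)).is_const_of_fderivWithin_eq_zero (𝕜 := ℝ)
        (f := convolution ((φ n).normed volume) F (ContinuousLinearMap.lsmul ℝ ℝ) volume)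
        (fun z hz => (hd z hz).differentiableAt.differentiableWithinAt)
        (fun z hz => by
          rw [fderivWithin_of_isOpen Metric.isOpen_ball hz, (hd z hz).fderiv]) hy
        (Metric.mem_ball_self (half_pos hr))
      exact this
    have hyΩ : y ∈ Ω := hball (Metric.ball_subset_ball (by linarith) hy)
    exact tendsto_nhds_unique (hlim y hyΩ) ((hlim x₀ hx₀).congr fun n => (hconst n).symm)
  have hd : ∀ x ∈ Ω, HasFDerivAt f (0 : EuclideanSpace ℝ (Fin N) →L[ℝ] ℝ) x := fun x hx =>
    (hasFDerivAt_const (f x) x).congr_of_eventuallyEq (hlocal x hx)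
  intro x hx y hy
  exact ho.is_const_of_fderiv_eq_zero hc
    (fun z hz => (hd z hz).differentiableAt.differentiableWithinAt)
    (fun z hz => (hd z hz).fderiv) hx hy

end WeaklyConstant

end

section

/-! ### Convexity and monotonicity of `H` -/

section Primitive

variable {h : ℝ → ℝ}

/-- The extension of `h|[0,∞)` to `ℝ` which is constant on `(-∞,0]`. -/
def extendNeg (h : ℝ → ℝ) (t : ℝ) : ℝ := h (max t 0)

theorem CondH1.continuous_extendNeg (h1 : CondH1 h) : Continuous (extendNeg h) :=
  h1.continuousOn.comp_continuous (by fun_prop) (fun t => le_max_right t 0)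

theorem primH_extendNeg {t : ℝ} (ht : 0 ≤ t) : primH (extendNeg h) t = primH h t := by
  refine intervalIntegral.integral_congr fun s hs => ?_
  rw [uIcc_of_le ht] at hs
  simp [extendNeg, hs.1]

/-- Extending `h` continuously makes the primitive differentiable on the whole line, so derivative
criteria apply; their conclusions return to `primH h` by agreement on `[0,∞)`. -/
theorem CondH1.hasDerivAt_primH_extendNeg (h1 : CondH1 h) (t : ℝ) :
    HasDerivAt (primH (extendNeg h)) (extendNeg h t) t :=
  intervalIntegral.integral_hasDerivAt_right
    (h1.continuous_extendNeg.intervalIntegrable _ _)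
    (h1.continuous_extendNeg.stronglyMeasurableAtFilter _ _) h1.continuous_extendNeg.continuousAt

theorem CondH1.continuous_primH_extendNeg (h1 : CondH1 h) :
    Continuous (primH (extendNeg h)) :=
  continuous_iff_continuousAt.2 fun t => (h1.hasDerivAt_primH_extendNeg t).continuousAt

theorem eqOn_primH_extendNeg : EqOn (primH (extendNeg h)) (primH h) (Ici 0) :=
  fun _ ht => primH_extendNeg ht

theorem eqOn_deriv_primH_extendNeg (h1 : CondH1 h) :
    EqOn h (deriv (primH (extendNeg h))) (interior (Ici 0)) := fun t ht => by
  rw [interior_Ici, mem_Ioi] at ht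
  rw [(h1.hasDerivAt_primH_extendNeg t).deriv, extendNeg, max_eq_left ht.le]

theorem CondH1.convexOn_primH (h1 : CondH1 h) : ConvexOn ℝ (Ici 0) (primH h) := by
  refine ConvexOn.congr (MonotoneOn.convexOn_of_deriv (convex_Ici 0)
    h1.continuous_primH_extendNeg.continuousOn
    (fun t _ => (h1.hasDerivAt_primH_extendNeg t).differentiableAt.differentiableWithinAt) ?_)
    eqOn_primH_extendNeg
  exact (h1.monotoneOn.mono interior_subset).congr (eqOn_deriv_primH_extendNeg h1)

theorem CondH1.strictConvexOn_primH (h1 : CondH1 h) (hs : StrictMonoOn h (Ici 0)) :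
    StrictConvexOn ℝ (Ici 0) (primH h) := by
  refine StrictConvexOn.congr (StrictMonoOn.strictConvexOn_of_deriv (convex_Ici 0)
    h1.continuous_primH_extendNeg.continuousOn ?_) eqOn_primH_extendNeg
  exact (hs.mono interior_subset).congr (eqOn_deriv_primH_extendNeg h1)

theorem CondH1.monotoneOn_primH (h1 : CondH1 h) : MonotoneOn (primH h) (Ici 0) := by
  refine MonotoneOn.congr (monotoneOn_of_deriv_nonneg (convex_Ici 0)
    h1.continuous_primH_extendNeg.continuousOn
    (fun t _ => (h1.hasDerivAt_primH_extendNeg t).differentiableAt.differentiableWithinAt)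
    fun t ht => ?_) eqOn_primH_extendNeg
  rw [← eqOn_deriv_primH_extendNeg h1 ht]
  exact h1.nonneg t (interior_subset ht)

theorem CondH1.strictMonoOn_primH (h1 : CondH1 h) (hpos : ∀ s, 0 < s → 0 < h s) :
    StrictMonoOn (primH h) (Ici 0) := by
  refine StrictMonoOn.congr (strictMonoOn_of_deriv_pos (convex_Ici 0)
    h1.continuous_primH_extendNeg.continuousOn fun t ht => ?_) eqOn_primH_extendNeg
  rw [← eqOn_deriv_primH_extendNeg h1 ht]
  rw [interior_Ici] at ht
  exact hpos t ht

theorem CondH1.abs_primH_le (h1 : CondH1 h) :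
    ∃ M : ℝ, ∀ t, 0 ≤ t → |primH h t| ≤ M * t := by
  obtain ⟨M, hM⟩ := h1.bounded
  refine ⟨M, fun t ht => ?_⟩
  have := intervalIntegral.norm_integral_le_of_norm_le_const (a := 0) (b := t) (f := h) (C := M)
    (fun s hs => by
      rw [uIoc_of_le ht] at hs
      rw [Real.norm_of_nonneg (h1.nonneg s hs.1.le)]
      exact hM s hs.1.le)
  simpa [primH, abs_of_nonneg ht] using this

end Primitive

/-! ### Integrability of the gradient term and existence of the means in `W_0^{1,p}(Ω)` -/

variable {N : ℕ} {Ω : Set (EuclideanSpace ℝ (Fin N))} {p : ℝ} [hp : Fact (1 < p)]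

theorem CondH1.integrable_primH {h : ℝ → ℝ} (h1 : CondH1 h) (u : W0 N Ω p) :
    Integrable (fun x => primH h (‖grad u x‖ ^ p)) (volume.restrict Ω) := by
  have hp0 : 0 < p := by linarith [hp.out]
  obtain ⟨M, hM⟩ := h1.abs_primH_le
  have hi : Integrable (fun x => ‖grad u x‖ ^ p) (volume.restrict Ω) := by
    have := (memLp_grad u).integrable_norm_rpow
      (zero_lt_one.trans_le one_le_ofReal).ne' ENNReal.ofReal_ne_top
    rwa [ENNReal.toReal_ofReal hp0.le] at this
  refine (hi.const_mul M).mono' ?_ (Eventually.of_forall fun x => hM _ (by positivity))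
  have : (fun x => primH h (‖grad u x‖ ^ p))
      = fun x => primH (extendNeg h) (‖grad u x‖ ^ p) := by
    ext x; rw [primH_extendNeg (by positivity)]
  rw [this]
  exact h1.continuous_primH_extendNeg.comp_aestronglyMeasurable hi.1

/-- `w` is the weighted `ℓ^p` mean of `u` and `v`, with the corresponding gradient. -/
structure IsPMean (t : ℝ) (u v w : W0 N Ω p) : Prop where
  val_eq : val w =ᵐ[volume.restrict Ω] fun x => pMean p t (val u x) (val v x)
  grad_eq : grad w =ᵐ[volume.restrict Ω] fun x =>
    pMeanGrad p t (val u x) (val v x) (grad u x) (grad v x)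

/-- The regularised means lie in `W_0^{1,p}` by the chain rule. Their partial derivatives are at
most `1` uniformly in `c`, so the values are dominated by `2(|u| + |v|)` and the gradients by `|∇u|
+ |∇v|`. Positivity identifies the pointwise limits. -/
theorem exists_isPMean {u v : W0 N Ω p} (hu : ∀ᵐ x ∂(volume.restrict Ω), 0 < val u x)
    (hv : ∀ᵐ x ∂(volume.restrict Ω), 0 < val v x) {t : ℝ} (ht0 : 0 ≤ t) (ht1 : t ≤ 1) :
    ∃ w : W0 N Ω p, IsPMean t u v w := by
  have hp0 : 0 < p := by linarith [hp.out]
  let c : ℕ → ℝ := fun n => 1 / ((n : ℝ) + 1)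
  have hc : ∀ n, 0 < c n := fun n => by positivity
  have hclim : Tendsto c atTop (𝓝 0) := tendsto_one_div_add_atTop_nhds_zero_nat
  have hb₁ : ∀ n z, |regMeanPartial p t (c n) (1 - t) z.1 z| ≤ 1 := fun n z =>
    abs_regMeanPartial_le hp.out (hc n) (by linarith) (by linarith)
      (le_add_of_nonneg_right (mul_nonneg ht0 (regPow_pos p (hc n) _).le))
      (regMean_base_pos p (hc n) ht0 ht1 z)
  have hb₂ : ∀ n z, |regMeanPartial p t (c n) t z.2 z| ≤ 1 := fun n z =>
    abs_regMeanPartial_le hp.out (hc n) ht0 ht1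
      (le_add_of_nonneg_left (mul_nonneg (by linarith) (regPow_pos p (hc n) _).le))
      (regMean_base_pos p (hc n) ht0 ht1 z)
  have hd := fun n z => hasFDerivAt_regMean hp0 (hc n) ht0 ht1 z
  choose w hw1 hw2 using fun n => exists_W0_comp (contDiff_regMean p (hc n) ht0 ht1)
    (regMean_zero p t (c n)) (hd n) (hb₁ n) (hb₂ n) u v
  suffices H : ∃ y : W0 N Ω p,
      val y =ᵐ[volume.restrict Ω] (fun x => pMean p t (val u x) (val v x)) ∧
      grad y =ᵐ[volume.restrict Ω] fun x =>
        pMeanGrad p t (val u x) (val v x) (grad u x) (grad v x) from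
    H.imp fun _ hy => ⟨hy.1, hy.2⟩
  refine exists_W0_of_dominated (w := w)
    (f := fun x => pMean p t (val u x) (val v x))
    (X := fun x => pMeanGrad p t (val u x) (val v x) (grad u x) (grad v x))
    (((memLp_val u).norm.add (memLp_val v).norm).const_mul 2)
    ((memLp_grad u).norm.add (memLp_grad v).norm) (fun n => ?_) (fun n => ?_) ?_ ?_
  · filter_upwards [hw1 n] with x hx
    have := abs_sub_le_of_partials (hd n) (hb₁ n) (hb₂ n) (val u x, val v x) 0
    rw [regMean_zero] at this
    simpa [hx] using this
  · filter_upwards [hw2 n] with x hx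
    rw [hx]
    refine (norm_add_le _ _).trans ?_
    rw [norm_smul, norm_smul]
    exact add_le_add (mul_le_of_le_one_left (norm_nonneg _) (hb₁ n _))
      (mul_le_of_le_one_left (norm_nonneg _) (hb₂ n _))
  · filter_upwards [hu, hv, ae_all_iff.2 hw1] with x hux hvx hx
    simp_rw [hx]
    exact (regMean_tendsto hp0 hux hvx).comp hclim
  · filter_upwards [hu, hv, ae_all_iff.2 hw2] with x hux hvx hx
    simp_rw [hx]
    rw [pMeanGrad, smul_add, smul_smul, smul_smul]
    exact (((regMeanPartial_tendsto hp0 hux hvx hux ht0 ht1).comp hclim).smul_const _).add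
      (((regMeanPartial_tendsto hp0 hux hvx hvx ht0 ht1).comp hclim).smul_const _)

/-! ### Convexity of the energy along the path of means -/

section Energy

variable {h : ℝ → ℝ} {g : EuclideanSpace ℝ (Fin N) → ℝ → ℝ} {u v w : W0 N Ω p} {t : ℝ}

theorem norm_grad_rpow_le (hu : ∀ᵐ x ∂(volume.restrict Ω), 0 < val u x)
    (hv : ∀ᵐ x ∂(volume.restrict Ω), 0 < val v x) (ht0 : 0 ≤ t) (ht1 : t ≤ 1)
    (hw : IsPMean t u v w) :
    ∀ᵐ x ∂(volume.restrict Ω),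
      ‖grad w x‖ ^ p ≤ (1 - t) * ‖grad u x‖ ^ p + t * ‖grad v x‖ ^ p := by
  filter_upwards [hu, hv, hw.grad_eq] with x h1 h2 h3
  rw [h3]
  exact norm_pMeanGrad_rpow_le hp.out h1 h2 ht0 ht1 _ _

theorem primH_grad_le (hh : CondH1 h) (hu : ∀ᵐ x ∂(volume.restrict Ω), 0 < val u x)
    (hv : ∀ᵐ x ∂(volume.restrict Ω), 0 < val v x) (ht0 : 0 ≤ t) (ht1 : t ≤ 1)
    (hw : IsPMean t u v w) :
    ∀ᵐ x ∂(volume.restrict Ω), primH h (‖grad w x‖ ^ p) ≤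
      (1 - t) * primH h (‖grad u x‖ ^ p) + t * primH h (‖grad v x‖ ^ p) := by
  have : 0 ≤ 1 - t := by linarith
  filter_upwards [norm_grad_rpow_le hu hv ht0 ht1 hw] with x hx
  refine (hh.monotoneOn_primH (mem_Ici.2 (by positivity)) (mem_Ici.2 (by positivity)) hx).trans ?_
  exact hh.convexOn_primH.2 (mem_Ici.2 (by positivity)) (mem_Ici.2 (by positivity)) this ht0
    (by ring)

theorem le_primG_val (hΩ : MeasurableSet Ω) (h3 : CondH3 Ω p g)
    (hu : ∀ᵐ x ∂(volume.restrict Ω), 0 < val u x)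
    (hv : ∀ᵐ x ∂(volume.restrict Ω), 0 < val v x) (ht0 : 0 ≤ t) (ht1 : t ≤ 1)
    (hw : IsPMean t u v w) :
    ∀ᵐ x ∂(volume.restrict Ω),
      (1 - t) * primG g x (val u x) + t * primG g x (val v x) ≤ primG g x (val w x) := by
  have hp0 : 0 < p := by linarith [hp.out]
  have : 0 ≤ 1 - t := by linarith
  filter_upwards [hu, hv, hw.val_eq, ae_restrict_mem hΩ] with x h1 h2 hx hxΩ
  have := (h3 x hxΩ).2 (mem_Ici.2 (by positivity : 0 ≤ val u x ^ p))
    (mem_Ici.2 (by positivity : 0 ≤ val v x ^ p)) this ht0 (by ring)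
  simp only [smul_eq_mul] at this
  rw [← Real.rpow_mul h1.le, ← Real.rpow_mul h2.le, mul_one_div_cancel hp0.ne', Real.rpow_one,
    Real.rpow_one] at this
  rw [hx]
  exact this

theorem integral_primH_grad_le (hh : CondH1 h) (hu : ∀ᵐ x ∂(volume.restrict Ω), 0 < val u x)
    (hv : ∀ᵐ x ∂(volume.restrict Ω), 0 < val v x) (ht0 : 0 ≤ t) (ht1 : t ≤ 1)
    (hw : IsPMean t u v w) :
    ∫ x in Ω, primH h (‖grad w x‖ ^ p) ≤
      (1 - t) * (∫ x in Ω, primH h (‖grad u x‖ ^ p)) +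
        t * ∫ x in Ω, primH h (‖grad v x‖ ^ p) := by
  have i1 := (hh.integrable_primH u).const_mul (1 - t)
  have i2 := (hh.integrable_primH v).const_mul t
  rw [← integral_const_mul, ← integral_const_mul, ← integral_add i1 i2]
  exact integral_mono_ae (hh.integrable_primH w) (i1.add i2)
    (primH_grad_le hh hu hv ht0 ht1 hw)

theorem le_integral_primG_val (hΩ : MeasurableSet Ω) (h2 : CondH2 Ω p g) (h3 : CondH3 Ω p g)
    (hu : ∀ᵐ x ∂(volume.restrict Ω), 0 < val u x)
    (hv : ∀ᵐ x ∂(volume.restrict Ω), 0 < val v x) (ht0 : 0 ≤ t) (ht1 : t ≤ 1)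
    (hw : IsPMean t u v w) :
    (1 - t) * (∫ x in Ω, primG g x (val u x)) + t * (∫ x in Ω, primG g x (val v x)) ≤
      ∫ x in Ω, primG g x (val w x) := by
  have i1 := (h2.integrable_primG u).const_mul (1 - t)
  have i2 := (h2.integrable_primG v).const_mul t
  rw [← integral_const_mul, ← integral_const_mul, ← integral_add i1 i2]
  exact integral_mono_ae (i1.add i2) (h2.integrable_primG w)
    (le_primG_val hΩ h3 hu hv ht0 ht1 hw)

/-- The energy is convex along the path of `ℓ^p` means. -/
theorem energy_isPMean_le (hΩ : MeasurableSet Ω) (hh : CondH1 h) (h2 : CondH2 Ω p g)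
    (h3 : CondH3 Ω p g) (hu : ∀ᵐ x ∂(volume.restrict Ω), 0 < val u x)
    (hv : ∀ᵐ x ∂(volume.restrict Ω), 0 < val v x) (ht0 : 0 ≤ t) (ht1 : t ≤ 1)
    (hw : IsPMean t u v w) :
    energy h g w ≤ (1 - t) * energy h g u + t * energy h g v := by
  have hp0 : 0 < p := by linarith [hp.out]
  have a1 := mul_le_mul_of_nonneg_left (integral_primH_grad_le hh hu hv ht0 ht1 hw)
    (by positivity : 0 ≤ 1 / p)
  have a2 := le_integral_primG_val hΩ h2 h3 hu hv ht0 ht1 hw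
  simp only [energy]
  linarith

/-- This linear rate turns the `o(‖w - u‖)` of Fréchet differentiability into `o(t)`. -/
theorem exists_norm_isPMean_sub_le (hu : ∀ᵐ x ∂(volume.restrict Ω), 0 < val u x)
    (hv : ∀ᵐ x ∂(volume.restrict Ω), 0 < val v x) {d : ℝ} (hd : 1 ≤ d)
    (hle : ∀ᵐ x ∂(volume.restrict Ω), val v x ≤ d * val u x) :
    ∃ K : ℝ, 0 ≤ K ∧ ∀ t, 0 ≤ t → t ≤ 1 / 2 → ∀ w, IsPMean t u v w → ‖w - u‖ ≤ K * t := by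
  obtain ⟨C, hC, hlip⟩ := exists_pMean_lipschitz_zero (E := EuclideanSpace ℝ (Fin N)) hp.out hd
  have hm : MemLp (fun x => ‖grad u x‖ + ‖grad v x‖) (ENNReal.ofReal p) (volume.restrict Ω) :=
    (memLp_grad u).norm.add (memLp_grad v).norm
  refine ⟨C * (‖u.1.1‖ + ‖hm.toLp _‖), by positivity, fun t ht0 ht w hw => ?_⟩
  have e1 : ‖(w - u).1.1‖ ≤ C * t * ‖u.1.1‖ := by
    refine Lp.norm_le_mul_norm_of_ae_le_mul ?_
    filter_upwards [val_sub w u, hw.val_eq, hu, hv, hle] with x h1 h2 h3 h4 h5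
    change ‖val (w - u) x‖ ≤ C * t * ‖val u x‖
    rw [h1, h2, Real.norm_of_nonneg h3.le]
    exact (hlip t _ _ ht0 ht h3 h4 h5).1
  have e2 : ‖(w - u).1.2‖ ≤ C * t * ‖hm.toLp _‖ := by
    refine Lp.norm_le_mul_norm_of_ae_le_mul ?_
    filter_upwards [grad_sub w u, hw.grad_eq, hu, hv, hle, hm.coeFn_toLp] with x h1 h2 h3 h4 h5 h6
    change ‖grad (w - u) x‖ ≤ _
    rw [h1, h2, h6, Real.norm_of_nonneg (by positivity)]
    exact (hlip t _ _ ht0 ht h3 h4 h5).2 _ _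
  have e3 : ‖w - u‖ = max ‖(w - u).1.1‖ ‖(w - u).1.2‖ := rfl
  rw [e3]
  have : 0 ≤ C * t := by positivity
  refine max_le (e1.trans ?_) (e2.trans ?_) <;>
    nlinarith [norm_nonneg u.1.1, norm_nonneg (hm.toLp _)]

/-- A positive critical point minimises the energy among the positive functions it dominates. -/
theorem IsCritical.energy_le (hΩ : MeasurableSet Ω) (hh : CondH1 h) (h2 : CondH2 Ω p g)
    (h3 : CondH3 Ω p g) (hcrit : IsCritical h g u)
    (hu : ∀ᵐ x ∂(volume.restrict Ω), 0 < val u x)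
    (hv : ∀ᵐ x ∂(volume.restrict Ω), 0 < val v x) {d : ℝ} (hd : 1 ≤ d)
    (hle : ∀ᵐ x ∂(volume.restrict Ω), val v x ≤ d * val u x) :
    energy h g u ≤ energy h g v := by
  by_contra! hlt
  obtain ⟨K, hK, hnorm⟩ := exists_norm_isPMean_sub_le hu hv hd hle
  set D := energy h g u - energy h g v with hD
  have hD0 : 0 < D := by linarith
  -- Convexity makes the energy drop by at least `D * t` along the path, while criticality allows a
  -- change of at most `c * K * t`. The choice `c = D / (2 * (K + 1))` makes `c * K < D`, also when
  -- `K = 0`.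
  have hc : 0 < D / (2 * (K + 1)) := by positivity
  have hlo := (hasFDerivAt_iff_isLittleO.1 hcrit).def hc
  obtain ⟨ε, hε, hball⟩ := Metric.eventually_nhds_iff.1 hlo
  -- `1 / 2` is the range of the Lipschitz bound; the other entry ensures `K * t < ε`.
  set t := min (1 / 2) (ε / (2 * (K + 1))) with ht
  have ht0 : 0 < t := lt_min (by norm_num) (by positivity)
  have ht1 : t ≤ 1 / 2 := min_le_left _ _
  obtain ⟨w, hw⟩ := exists_isPMean hu hv ht0.le (by linarith)
  have hwn := hnorm t ht0.le ht1 w hw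
  have hKt : K * t < ε := by
    have : t ≤ ε / (2 * (K + 1)) := min_le_right _ _
    rw [le_div_iff₀ (by positivity)] at this
    nlinarith
  have h4 := hball (by rw [dist_eq_norm]; linarith : dist w u < ε)
  simp only [_root_.zero_apply, sub_zero] at h4
  have h5 := energy_isPMean_le hΩ hh h2 h3 hu hv ht0.le (by linarith) hw
  have h6 : D * t ≤ ‖energy h g w - energy h g u‖ := by
    rw [Real.norm_eq_abs]
    refine le_trans ?_ (neg_le_abs _)
    rw [hD]; linarith
  have h7 : D / (2 * (K + 1)) * ‖w - u‖ ≤ D / (2 * (K + 1)) * (K * t) :=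
    mul_le_mul_of_nonneg_left hwn hc.le
  have h8 : D / (2 * (K + 1)) * (K * t) < D * t := by
    rw [div_mul_eq_mul_div, div_lt_iff₀ (by positivity)]
    have : 0 < D * t := by positivity
    nlinarith
  linarith

theorem pMean_le {q a b d : ℝ} (hq : 0 < q) (ha : 0 < a) (hb : 0 < b) (hd : 1 ≤ d)
    (hle : b ≤ d * a) (ht0 : 0 ≤ t) (ht1 : t ≤ 1) : pMean q t a b ≤ d * a := by
  have h1 : a ^ q ≤ (d * a) ^ q := Real.rpow_le_rpow ha.le (by nlinarith) hq.le
  have h2 : b ^ q ≤ (d * a) ^ q := Real.rpow_le_rpow hb.le hle hq.le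
  rw [← Real.rpow_le_rpow_iff (pMean_pos ha hb ht0 ht1).le (by positivity) hq,
    pMean_rpow hq ha hb ht0 ht1]
  nlinarith [mul_le_mul_of_nonneg_left h1 (by linarith : 0 ≤ 1 - t),
    mul_le_mul_of_nonneg_left h2 ht0]

theorem ae_eq_of_integral_le {f k : EuclideanSpace ℝ (Fin N) → ℝ}
    (hf : Integrable f (volume.restrict Ω)) (hk : Integrable k (volume.restrict Ω))
    (hle : f ≤ᵐ[volume.restrict Ω] k) (hint : ∫ x in Ω, k x ≤ ∫ x in Ω, f x) :
    f =ᵐ[volume.restrict Ω] k := by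
  have h1 : ∫ x in Ω, (k x - f x) = 0 := by
    rw [integral_sub hk hf]
    linarith [integral_mono_ae hf hk hle]
  have h2 := (integral_eq_zero_iff_of_nonneg_ae (by
    filter_upwards [hle] with x hx using sub_nonneg.2 hx) (hk.sub hf)).1 h1
  filter_upwards [h2] with x hx
  exact (sub_eq_zero.1 hx).symm

/-- If the energy does not drop at the midpoint, both convexity inequalities are equalities. -/
theorem ae_eq_of_energy_le (hΩ : MeasurableSet Ω) (hh : CondH1 h) (h2 : CondH2 Ω p g)
    (h3 : CondH3 Ω p g) (hu : ∀ᵐ x ∂(volume.restrict Ω), 0 < val u x)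
    (hv : ∀ᵐ x ∂(volume.restrict Ω), 0 < val v x) (ht0 : 0 ≤ t) (ht1 : t ≤ 1)
    (hw : IsPMean t u v w)
    (hen : (1 - t) * energy h g u + t * energy h g v ≤ energy h g w) :
    (∀ᵐ x ∂(volume.restrict Ω), primH h (‖grad w x‖ ^ p) =
      (1 - t) * primH h (‖grad u x‖ ^ p) + t * primH h (‖grad v x‖ ^ p)) ∧
    ∀ᵐ x ∂(volume.restrict Ω),
      (1 - t) * primG g x (val u x) + t * primG g x (val v x) = primG g x (val w x) := by
  have hp0 : 0 < p := by linarith [hp.out]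
  have a1 := integral_primH_grad_le hh hu hv ht0 ht1 hw
  have a2 := le_integral_primG_val hΩ h2 h3 hu hv ht0 ht1 hw
  have hpp : 0 < 1 / p := by positivity
  have a3 := mul_le_mul_of_nonneg_left a1 hpp.le
  simp only [energy] at hen
  -- The energy is a sum of two terms, each convex along the path. If the sum attains its upper
  -- bound, each term does, which reverses each integral inequality.
  constructor
  · have i1 := (hh.integrable_primH u).const_mul (1 - t)
    have i2 := (hh.integrable_primH v).const_mul t
    refine ae_eq_of_integral_le (hh.integrable_primH w) (i1.add i2)
      (primH_grad_le hh hu hv ht0 ht1 hw) ?_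
    rw [integral_add i1 i2, integral_const_mul, integral_const_mul]
    refine le_of_mul_le_mul_left ?_ hpp
    linarith
  · have i1 := (h2.integrable_primG u).const_mul (1 - t)
    have i2 := (h2.integrable_primG v).const_mul t
    refine ae_eq_of_integral_le (i1.add i2) (h2.integrable_primG w)
      (le_primG_val hΩ h3 hu hv ht0 ht1 hw) ?_
    rw [integral_add i1 i2, integral_const_mul, integral_const_mul]
    linarith

end Energy

end

section

/-! ### Regularised logarithm of a quotient -/

section LogRatio

/-- The smooth approximation `½ log (a² + c) - ½ log (b² + c)` of `log a - log b`. -/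
noncomputable def regLogRatio (c : ℝ) (z : ℝ × ℝ) : ℝ :=
  1 / 2 * Real.log (z.1 ^ 2 + c) - 1 / 2 * Real.log (z.2 ^ 2 + c)

theorem contDiff_regLogRatio {c : ℝ} (hc : 0 < c) : ContDiff ℝ ∞ (regLogRatio c) := by
  unfold regLogRatio
  refine (contDiff_const.mul (ContDiff.log (by fun_prop) fun z => ?_)).sub
    (contDiff_const.mul (ContDiff.log (by fun_prop) fun z => ?_)) <;> positivity

theorem hasFDerivAt_regLogRatio {c : ℝ} (hc : 0 < c) (z : ℝ × ℝ) :
    HasFDerivAt (regLogRatio c) ((z.1 / (z.1 ^ 2 + c)) • ContinuousLinearMap.fst ℝ ℝ ℝ +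
      (-(z.2 / (z.2 ^ 2 + c))) • ContinuousLinearMap.snd ℝ ℝ ℝ) z := by
  have hd : ∀ a : ℝ, HasDerivAt (fun a : ℝ => 1 / 2 * Real.log (a ^ 2 + c)) (a / (a ^ 2 + c)) a :=
    fun a => by
      have h1 : HasDerivAt (fun a : ℝ => a ^ 2 + c) (2 * a) a := by
        simpa using (hasDerivAt_pow 2 a).add_const c
      refine ((h1.log (by positivity)).const_mul (1 / 2)).congr_deriv ?_
      ring
  have h1 : HasFDerivAt (fun z : ℝ × ℝ => 1 / 2 * Real.log (z.1 ^ 2 + c))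
      ((z.1 / (z.1 ^ 2 + c)) • ContinuousLinearMap.fst ℝ ℝ ℝ) z :=
    (hd z.1).comp_hasFDerivAt z (hasFDerivAt_fst (𝕜 := ℝ))
  have h2 : HasFDerivAt (fun z : ℝ × ℝ => 1 / 2 * Real.log (z.2 ^ 2 + c))
      ((z.2 / (z.2 ^ 2 + c)) • ContinuousLinearMap.snd ℝ ℝ ℝ) z :=
    (hd z.2).comp_hasFDerivAt z (hasFDerivAt_snd (𝕜 := ℝ))
  refine (h1.sub h2).congr_fderiv ?_
  ext <;> simp

theorem abs_div_sq_add_le {c : ℝ} (hc : 0 < c) (hc1 : c ≤ 1) (a : ℝ) :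
    |a / (a ^ 2 + c)| ≤ 1 / c := by
  rw [abs_div, abs_of_pos (by positivity : 0 < a ^ 2 + c), div_le_div_iff₀ (by positivity) hc,
    one_mul]
  nlinarith [sq_abs a, abs_nonneg a, sq_nonneg (|a| - 1)]

/-- Unlike the bound `1 / c`, this one survives `c → 0`; it is used on the support of a test
function, where `u` and `v` are bounded below. -/
theorem div_sq_add_le_inv {c a m : ℝ} (hc : 0 < c) (hm : 0 < m) (ha : m ≤ a) :
    |a / (a ^ 2 + c)| ≤ 1 / m := by
  have : 0 < a := hm.trans_le ha
  rw [abs_of_pos (by positivity), div_le_div_iff₀ (by positivity) hm]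
  nlinarith

/-- Since `d ≥ 1`, adding `c` to both squares does not spoil comparability: `a² + c ≤ d² (b² + c)`.
-/
theorem abs_regLogRatio_le {c a b d : ℝ} (hc : 0 < c) (hd : 1 ≤ d) (ha : 0 < a)
    (hb : 0 < b) (h1 : a ≤ d * b) (h2 : b ≤ d * a) : |regLogRatio c (a, b)| ≤ Real.log d := by
  have key : ∀ a b : ℝ, 0 < a → 0 < b → a ≤ d * b →
      1 / 2 * Real.log (a ^ 2 + c) ≤ 1 / 2 * Real.log (b ^ 2 + c) + Real.log d := by
    intro a b ha hb h1
    have e1 : a ^ 2 + c ≤ d ^ 2 * (b ^ 2 + c) := by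
      have : a ^ 2 ≤ (d * b) ^ 2 := pow_le_pow_left₀ ha.le h1 2
      nlinarith [mul_le_mul_of_nonneg_right (one_le_pow₀ hd : 1 ≤ d ^ 2) hc.le]
    have e2 := Real.log_le_log (by positivity) e1
    rw [Real.log_mul (by positivity) (by positivity), Real.log_pow] at e2
    push_cast at e2
    linarith
  rw [regLogRatio, abs_le]
  constructor
  · linarith [key b a hb ha h2]
  · linarith [key a b ha hb h1]

theorem regLogRatio_tendsto {a b : ℝ} (ha : 0 < a) (hb : 0 < b) :
    Tendsto (fun c => regLogRatio c (a, b)) (𝓝 0) (𝓝 (Real.log a - Real.log b)) := by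
  have key : ∀ a : ℝ, 0 < a →
      Tendsto (fun c : ℝ => 1 / 2 * Real.log (a ^ 2 + c)) (𝓝 0) (𝓝 (Real.log a)) := by
    intro a ha
    have h1 : Tendsto (fun c : ℝ => a ^ 2 + c) (𝓝 0) (𝓝 (a ^ 2 + 0)) :=
      tendsto_const_nhds.add tendsto_id
    have h2 := (h1.log (by positivity)).const_mul (1 / 2)
    have h3 : 1 / 2 * Real.log (a ^ 2 + 0) = Real.log a := by
      rw [add_zero, Real.log_pow]; push_cast; ring
    rwa [h3] at h2
  exact (key a ha).sub (key b hb)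

theorem div_sq_add_tendsto {a : ℝ} (ha : 0 < a) :
    Tendsto (fun c : ℝ => a / (a ^ 2 + c)) (𝓝 0) (𝓝 a⁻¹) := by
  have h1 : Tendsto (fun c : ℝ => a ^ 2 + c) (𝓝 0) (𝓝 (a ^ 2 + 0)) :=
    tendsto_const_nhds.add tendsto_id
  have h2 := (tendsto_const_nhds (x := a)).div h1 (by positivity)
  have h3 : a / (a ^ 2 + 0) = a⁻¹ := by field_simp; ring
  rwa [h3] at h2

end LogRatio

/-! ### Proportionality from equal logarithmic gradients -/

variable {N : ℕ} {Ω : Set (EuclideanSpace ℝ (Fin N))} {p : ℝ} [hp : Fact (1 < p)]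

/-- If `∇u / u = ∇v / v`, then `log u - log v` has vanishing weak gradient. -/
theorem integral_log_sub_log_mul_fderiv_eq_zero (hb : Bornology.IsBounded Ω)
    {u v : W0 N Ω p} (hu : ∀ᵐ x ∂(volume.restrict Ω), 0 < val u x)
    (hv : ∀ᵐ x ∂(volume.restrict Ω), 0 < val v x) {d : ℝ} (hd : 1 ≤ d)
    (huv : ∀ᵐ x ∂(volume.restrict Ω), val u x ≤ d * val v x)
    (hvu : ∀ᵐ x ∂(volume.restrict Ω), val v x ≤ d * val u x)
    (hgrad : ∀ᵐ x ∂(volume.restrict Ω), (val u x)⁻¹ • grad u x = (val v x)⁻¹ • grad v x)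
    {ψ : EuclideanSpace ℝ (Fin N) → ℝ} (hψ : IsTest Ω ψ) {m : ℝ} (hm : 0 < m)
    (hmu : ∀ᵐ x ∂(volume.restrict Ω), x ∈ tsupport ψ → m ≤ val u x)
    (hmv : ∀ᵐ x ∂(volume.restrict Ω), x ∈ tsupport ψ → m ≤ val v x)
    (e : EuclideanSpace ℝ (Fin N)) :
    ∫ x in Ω, (Real.log (val u x) - Real.log (val v x)) * fderiv ℝ ψ x e = 0 := by
  have := finite_restrict hb
  let c : ℕ → ℝ := fun n => 1 / ((n : ℝ) + 1)
  have hc : ∀ n, 0 < c n := fun n => by positivity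
  have hc1 : ∀ n, c n ≤ 1 := fun n => by
    rw [div_le_one (by positivity)]; linarith [(n.cast_nonneg : (0 : ℝ) ≤ n)]
  have hclim : Tendsto c atTop (𝓝 0) := tendsto_one_div_add_atTop_nhds_zero_nat
  have hψu : IsTest univ ψ := ⟨hψ.1, hψ.2.1, subset_univ _⟩
  have c2 : Continuous fun x => fderiv ℝ ψ x e := hψ.continuous_fderiv.clm_apply continuous_const
  obtain ⟨C₁, hC₁⟩ := (hψ.2.1).exists_bound_of_continuous hψ.1.continuous
  obtain ⟨C₂, hC₂⟩ := (hψ.2.1.fderiv_apply ℝ e).exists_bound_of_continuous c2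
  have hC₁0 : 0 ≤ C₁ := (norm_nonneg _).trans (hC₁ 0)
  -- `log u - log v` need not belong to `W_0^{1,p}`. Its regularisations do, since they vanish at
  -- the origin and have partial derivatives bounded for each fixed `c`, so integration by parts
  -- applies to them.
  choose w hw1 hw2 using fun n => exists_W0_comp (contDiff_regLogRatio (hc n))
    (by simp [regLogRatio]) (hasFDerivAt_regLogRatio (hc n))
    (fun z => abs_div_sq_add_le (hc n) (hc1 n) z.1)
    (fun z => by rw [abs_neg]; exact abs_div_sq_add_le (hc n) (hc1 n) z.2) u v
  have t1 : Tendsto (fun n => ∫ x in Ω, val (w n) x * fderiv ℝ ψ x e) atTop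
      (𝓝 (∫ x in Ω, (Real.log (val u x) - Real.log (val v x)) * fderiv ℝ ψ x e)) := by
    refine tendsto_integral_of_dominated_convergence (fun _ => Real.log d * C₂)
      (fun n => (memLp_val (w n)).1.mul c2.aestronglyMeasurable) (integrable_const _)
      (fun n => ?_) ?_
    · filter_upwards [hw1 n, hu, hv, huv, hvu] with x hx h1 h2 h3 h4
      rw [norm_mul, hx]
      exact mul_le_mul (abs_regLogRatio_le (hc n) hd h1 h2 h3 h4) (hC₂ x) (norm_nonneg _)
        (Real.log_nonneg hd)
    · filter_upwards [ae_all_iff.2 hw1, hu, hv] with x hx h1 h2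
      simp_rw [hx]
      exact ((regLogRatio_tendsto h1 h2).comp hclim).mul_const _
  -- Off the support of `ψ` the integrand is zero; on it the lower bound `m` gives a majorant
  -- uniform in `n`. The pointwise limit contains `∇u/u - ∇v/v = 0`.
  have t2 : Tendsto (fun n => ∫ x in Ω, inner ℝ (grad (w n) x) e * ψ x) atTop
      (𝓝 (∫ x in Ω, (0 : ℝ))) := by
    refine tendsto_integral_of_dominated_convergence
      (fun x => 1 / m * ‖e‖ * C₁ * (‖grad u x‖ + ‖grad v x‖))
      (fun n => ((memLp_grad (w n)).1.inner_const).mul hψ.1.continuous.aestronglyMeasurable)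
      (((integrable_grad hb u).norm.add (integrable_grad hb v).norm).const_mul _)
      (fun n => ?_) ?_
    · filter_upwards [hw2 n, hmu, hmv] with x hx h1 h2
      by_cases hxs : x ∈ tsupport ψ
      · rw [norm_mul, hx]
        have e1 : ‖(val u x / (val u x ^ 2 + c n)) • grad u x +
            (-(val v x / (val v x ^ 2 + c n))) • grad v x‖
            ≤ 1 / m * (‖grad u x‖ + ‖grad v x‖) := by
          refine (norm_add_le _ _).trans ?_
          rw [norm_smul, norm_smul, norm_neg, mul_add]
          exact add_le_add
            (mul_le_mul_of_nonneg_right (div_sq_add_le_inv (hc n) hm (h1 hxs)) (norm_nonneg _))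
            (mul_le_mul_of_nonneg_right (div_sq_add_le_inv (hc n) hm (h2 hxs)) (norm_nonneg _))
        have e2 := (norm_inner_le_norm (𝕜 := ℝ) ((val u x / (val u x ^ 2 + c n)) • grad u x +
            (-(val v x / (val v x ^ 2 + c n))) • grad v x) e).trans
            (mul_le_mul_of_nonneg_right e1 (norm_nonneg e))
        refine (mul_le_mul e2 (hC₁ x) (norm_nonneg _) (by positivity)).trans (le_of_eq ?_)
        ring
      · rw [image_eq_zero_of_notMem_tsupport hxs, mul_zero, norm_zero]
        positivity
    · filter_upwards [ae_all_iff.2 hw2, hu, hv, hgrad] with x hx h1 h2 h3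
      simp_rw [hx]
      have e1 : Tendsto (fun n => (val u x / (val u x ^ 2 + c n)) • grad u x +
          (-(val v x / (val v x ^ 2 + c n))) • grad v x) atTop (𝓝 0) := by
        have := (((div_sq_add_tendsto h1).comp hclim).smul_const (grad u x)).add
          (((div_sq_add_tendsto h2).comp hclim).neg.smul_const (grad v x))
        rwa [neg_smul, h3, add_neg_cancel] at this
      have e2 := (Tendsto.inner (𝕜 := ℝ) e1 (tendsto_const_nhds (x := e))).mul_const (ψ x)
      simpa using e2
  have t3 := t2.neg
  rw [integral_zero, neg_zero] at t3
  exact tendsto_nhds_unique t1 (t3.congr fun n => (setIntegral_val_mul_fderiv hb (w n) hψu e).symm)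

theorem IsTest.exists_pos_le {ψ f : EuclideanSpace ℝ (Fin N) → ℝ} (hψ : IsTest Ω ψ)
    (hf : ContinuousOn f Ω) (hpos : ∀ x ∈ Ω, 0 < f x) :
    ∃ m, 0 < m ∧ ∀ x ∈ tsupport ψ, m ≤ f x :=
  hψ.2.1.isCompact.exists_forall_le' (hf.mono hψ.2.2) fun x hx => hpos x (hψ.2.2 hx)

/-- Comparable positive functions with the same logarithmic gradient are proportional. -/
theorem exists_eq_smul_of_log_grad_eq (ho : IsOpen Ω) (hc : IsConnected Ω)
    (hb : Bornology.IsBounded Ω) {u v : W0 N Ω p} (hu : IsPositive u) (hv : IsPositive v)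
    (hcu : IsContinuousUpToBoundary u) (hcv : IsContinuousUpToBoundary v) {d : ℝ} (hd : 1 ≤ d)
    (huv : ∀ᵐ x ∂(volume.restrict Ω), val u x ≤ d * val v x)
    (hvu : ∀ᵐ x ∂(volume.restrict Ω), val v x ≤ d * val u x)
    (hgrad : ∀ᵐ x ∂(volume.restrict Ω), (val u x)⁻¹ • grad u x = (val v x)⁻¹ • grad v x) :
    ∃ α : ℝ, 0 < α ∧ u = α • v := by
  have := finite_restrict hb
  obtain ⟨f, hf, hfu⟩ := hcu
  obtain ⟨k, hk, hkv⟩ := hcv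
  replace hf := hf.mono subset_closure
  replace hk := hk.mono subset_closure
  -- Positivity of the continuous representatives at every point, not just almost everywhere, gives
  -- continuous logarithms and positive lower bounds on compact sets.
  have hf0 := hu.2 f hf hfu
  have hk0 := hv.2 k hk hkv
  have hlc : ContinuousOn (fun x => Real.log (f x) - Real.log (k x)) Ω :=
    (hf.log fun x hx => (hf0 x hx).ne').sub (hk.log fun x hx => (hk0 x hx).ne')
  have hli : IntegrableOn (fun x => Real.log (f x) - Real.log (k x)) Ω := by
    refine Integrable.of_bound (hlc.aestronglyMeasurable ho.measurableSet) (Real.log d) ?_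
    filter_upwards [hfu, hkv, hu.1, hv.1, huv, hvu] with x h1 h2 h3 h4 h5 h6
    rw [← h1, ← h2, Real.norm_eq_abs, abs_le]
    have e1 := Real.log_le_log h3 h5
    have e2 := Real.log_le_log h4 h6
    rw [Real.log_mul (by positivity) (by positivity)] at e1 e2
    constructor <;> linarith
  have hconst := eqOn_const_of_weak_gradient_eq_zero ho hc.isPreconnected hlc hli
    fun ψ hψ e => by
      obtain ⟨m₁, hm₁, hm₁f⟩ := hψ.exists_pos_le hf hf0
      obtain ⟨m₂, hm₂, hm₂k⟩ := hψ.exists_pos_le hk hk0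
      refine Eq.trans (integral_congr_ae ?_) (integral_log_sub_log_mul_fderiv_eq_zero hb hu.1
        hv.1 hd huv hvu hgrad hψ (lt_min hm₁ hm₂) ?_ ?_ e)
      · filter_upwards [hfu, hkv] with x h1 h2
        rw [h1, h2]
      · filter_upwards [hfu] with x h1 hx
        rw [h1]; exact (min_le_left _ _).trans (hm₁f x hx)
      · filter_upwards [hkv] with x h1 hx
        rw [h1]; exact (min_le_right _ _).trans (hm₂k x hx)
  obtain ⟨x₀, hx₀⟩ := hc.nonempty
  have hα : 0 < f x₀ / k x₀ := div_pos (hf0 x₀ hx₀) (hk0 x₀ hx₀)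
  refine ⟨f x₀ / k x₀, hα, W0.eq_of_val_eq hb ?_⟩
  filter_upwards [hfu, hkv, val_smul (f x₀ / k x₀) v, ae_restrict_mem ho.measurableSet]
    with x h1 h2 h3 hx
  rw [h3, h1, h2]
  have h4 := hconst x hx x₀ hx₀
  rw [← Real.log_div (hf0 x hx).ne' (hk0 x hx).ne',
    ← Real.log_div (hf0 x₀ hx₀).ne' (hk0 x₀ hx₀).ne'] at h4
  have h5 := Real.log_injOn_pos (mem_Ioi.2 (div_pos (hf0 x hx) (hk0 x hx))) (mem_Ioi.2 hα) h4
  rw [← h5, div_mul_cancel₀ _ (hk0 x hx).ne']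

/-! ### Rigidity of comparable positive critical points -/

section Main

variable {h : ℝ → ℝ} {g : EuclideanSpace ℝ (Fin N) → ℝ → ℝ} {u v : W0 N Ω p}

theorem AreComparable.exists_le (hc : AreComparable u v) :
    ∃ d : ℝ, 1 ≤ d ∧ (∀ᵐ x ∂(volume.restrict Ω), val u x ≤ d * val v x) ∧
      ∀ᵐ x ∂(volume.restrict Ω), val v x ≤ d * val u x := by
  obtain ⟨d, hd, hle⟩ := hc
  have hd0 : 0 < d := by linarith
  refine ⟨d, hd, hle.mono fun x hx => hx.2, hle.mono fun x hx => ?_⟩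
  have := hx.1
  rwa [inv_mul_le_iff₀ hd0] at this

theorem energy_eq_of_mem_posCrit (hΩ : MeasurableSet Ω) (hh : CondH1 h) (h2 : CondH2 Ω p g)
    (h3 : CondH3 Ω p g) (hu : u ∈ posCrit Ω p h g) (hv : v ∈ posCrit Ω p h g)
    (hc : AreComparable u v) : energy h g u = energy h g v := by
  obtain ⟨d, hd, huv, hvu⟩ := hc.exists_le
  exact le_antisymm (hu.1.energy_le hΩ hh h2 h3 hu.2.1 hv.2.1 hd hvu)
    (hv.1.energy_le hΩ hh h2 h3 hv.2.1 hu.2.1 hd huv)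

/-- Along the midpoint of two comparable positive critical points, the two convexity inequalities
are equalities. -/
theorem exists_midpoint_eq (hΩ : MeasurableSet Ω) (hh : CondH1 h) (h2 : CondH2 Ω p g)
    (h3 : CondH3 Ω p g) (hu : u ∈ posCrit Ω p h g) (hv : v ∈ posCrit Ω p h g)
    (hc : AreComparable u v) :
    ∃ w : W0 N Ω p, IsPMean (1 / 2) u v w ∧
      (∀ᵐ x ∂(volume.restrict Ω), primH h (‖grad w x‖ ^ p) =
        (1 - 1 / 2) * primH h (‖grad u x‖ ^ p) + 1 / 2 * primH h (‖grad v x‖ ^ p)) ∧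
      ∀ᵐ x ∂(volume.restrict Ω), (1 - 1 / 2) * primG g x (val u x) +
        1 / 2 * primG g x (val v x) = primG g x (val w x) := by
  have hp0 : 0 < p := by linarith [hp.out]
  obtain ⟨d, hd, huv, hvu⟩ := hc.exists_le
  obtain ⟨w, hw⟩ := exists_isPMean hu.2.1 hv.2.1 (t := 1 / 2) (by norm_num) (by norm_num)
  have hwpos : ∀ᵐ x ∂(volume.restrict Ω), 0 < val w x := by
    filter_upwards [hu.2.1, hv.2.1, hw.val_eq] with x h1 h2 h3
    rw [h3]; exact pMean_pos h1 h2 (by norm_num) (by norm_num)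
  -- The midpoint is itself dominated by `u`, so minimality of `u` gives `I(u) ≤ I(w)`; as `I(u) =
  -- I(v)`, the energy does not drop at the midpoint.
  have hwle : ∀ᵐ x ∂(volume.restrict Ω), val w x ≤ d * val u x := by
    filter_upwards [hu.2.1, hv.2.1, hw.val_eq, hvu] with x h1 h2 h3 h4
    rw [h3]; exact pMean_le hp0 h1 h2 hd h4 (by norm_num) (by norm_num)
  have hen := hu.1.energy_le hΩ hh h2 h3 hu.2.1 hwpos hd hwle
  have heq := energy_eq_of_mem_posCrit hΩ hh h2 h3 hu hv hc
  exact ⟨w, hw, ae_eq_of_energy_le hΩ hh h2 h3 hu.2.1 hv.2.1 (by norm_num) (by norm_num) hw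
    (by rw [← heq]; linarith)⟩

/-- Midpoint equality and convexity of `H` put `H` of the averaged `|∇u|^p`, `|∇v|^p` below
`H(|∇w|^p)`. Strict monotonicity removes `H`, leaving the equality case of hidden convexity. -/
theorem log_grad_eq_of_mem_posCrit (hΩ : MeasurableSet Ω) (hh : CondH1 h) (h2 : CondH2 Ω p g)
    (h3 : CondH3 Ω p g) (hpos : ∀ s, 0 < s → 0 < h s) (hu : u ∈ posCrit Ω p h g)
    (hv : v ∈ posCrit Ω p h g) (hc : AreComparable u v) :
    ∀ᵐ x ∂(volume.restrict Ω), (val u x)⁻¹ • grad u x = (val v x)⁻¹ • grad v x := by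
  obtain ⟨w, hw, heq, -⟩ := exists_midpoint_eq hΩ hh h2 h3 hu hv hc
  filter_upwards [hu.2.1, hv.2.1, hw.grad_eq, heq] with x e1 e2 e3 e4
  refine smul_eq_of_norm_pMeanGrad_rpow_eq hp.out e1 e2 (t := 1 / 2) (by norm_num) (by norm_num) ?_
  rw [← e3]
  have e5 := hh.convexOn_primH.2 (mem_Ici.2 (by positivity : 0 ≤ ‖grad u x‖ ^ p))
    (mem_Ici.2 (by positivity : 0 ≤ ‖grad v x‖ ^ p)) (by norm_num : (0 : ℝ) ≤ 1 - 1 / 2)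
    (by norm_num : (0 : ℝ) ≤ 1 / 2) (by ring)
  simp only [smul_eq_mul] at e5
  rw [← e4] at e5
  exact ((hh.strictMonoOn_primH hpos).le_iff_le (mem_Ici.2 (by positivity))
    (mem_Ici.2 (by positivity))).1 e5

/-- Strict convexity of `H` forces `|∇u| = |∇v|`. Where this is nonzero, `∇u/u = ∇v/v` forces `u =
v` and so `∇u = ∇v`; elsewhere both gradients vanish. Poincaré applied to `u - v` concludes. -/
theorem eq_of_strictMonoOn (hN : 1 ≤ N) (hΩ : MeasurableSet Ω) (hb : Bornology.IsBounded Ω)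
    (hh : CondH1 h) (h2 : CondH2 Ω p g) (h3 : CondH3 Ω p g) (hs : StrictMonoOn h (Ici 0))
    (hu : u ∈ posCrit Ω p h g) (hv : v ∈ posCrit Ω p h g) (hc : AreComparable u v) : u = v := by
  have hp0 : 0 < p := by linarith [hp.out]
  have hpos : ∀ s, 0 < s → 0 < h s := fun s hs0 =>
    (hh.nonneg 0 le_rfl).trans_lt (hs (mem_Ici.2 le_rfl) (mem_Ici.2 hs0.le) hs0)
  have hlog := log_grad_eq_of_mem_posCrit hΩ hh h2 h3 hpos hu hv hc
  obtain ⟨w, hw, heq, -⟩ := exists_midpoint_eq hΩ hh h2 h3 hu hv hc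
  have hgrad : ∀ᵐ x ∂(volume.restrict Ω), grad u x = grad v x := by
    filter_upwards [hu.2.1, hv.2.1, hlog, heq, norm_grad_rpow_le hu.2.1 hv.2.1 (by norm_num)
      (by norm_num) hw] with x e1 e2 e3 e4 e5
    have hn : ‖grad u x‖ ^ p = ‖grad v x‖ ^ p := by
      by_contra hne
      have e6 := (hh.strictConvexOn_primH hs).2 (mem_Ici.2 (by positivity : 0 ≤ ‖grad u x‖ ^ p))
        (mem_Ici.2 (by positivity : 0 ≤ ‖grad v x‖ ^ p)) hne
        (by norm_num : (0 : ℝ) < 1 - 1 / 2) (by norm_num : (0 : ℝ) < 1 / 2) (by ring)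
      have e7 := hh.monotoneOn_primH (mem_Ici.2 (by positivity : 0 ≤ ‖grad w x‖ ^ p))
        (mem_Ici.2 (by positivity)) e5
      simp only [smul_eq_mul] at e6
      linarith
    have hn' : ‖grad u x‖ = ‖grad v x‖ :=
      Real.rpow_left_injOn hp0.ne' (norm_nonneg _) (norm_nonneg _) hn
    by_cases hz : grad v x = 0
    · rw [hz, norm_zero, norm_eq_zero] at hn'
      rw [hn', hz]
    · have e8 := congrArg norm e3
      rw [norm_smul, norm_smul, hn'] at e8
      have e9 := mul_right_cancel₀ (norm_ne_zero_iff.2 hz) e8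
      rw [norm_inv, norm_inv, Real.norm_of_nonneg e1.le, Real.norm_of_nonneg e2.le, inv_inj] at e9
      rw [e9] at e3
      exact smul_right_injective _ (inv_ne_zero e2.ne') e3
  have h0 : grad (u - v) =ᵐ[volume.restrict Ω] 0 := by
    filter_upwards [grad_sub u v, hgrad] with x e1 e2
    simp [e1, e2]
  refine W0.eq_of_val_eq hb ?_
  filter_upwards [val_eq_zero_of_grad_eq_zero hN hb h0, val_sub u v] with x e1 e2
  exact sub_eq_zero.1 (e2.symm.trans e1)

theorem eq_of_strictH3 (hΩ : MeasurableSet Ω) (hb : Bornology.IsBounded Ω)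
    (hh : CondH1 h) (h2 : CondH2 Ω p g) (h3 : CondH3 Ω p g) (hs : StrictH3 Ω p g)
    (hu : u ∈ posCrit Ω p h g) (hv : v ∈ posCrit Ω p h g) (hc : AreComparable u v) : u = v := by
  have hp0 : 0 < p := by linarith [hp.out]
  obtain ⟨w, hw, -, heq⟩ := exists_midpoint_eq hΩ hh h2 h3 hu hv hc
  refine W0.eq_of_val_eq hb ?_
  filter_upwards [hu.2.1, hv.2.1, hw.val_eq, heq, ae_restrict_mem hΩ] with x e1 e2 e3 e4 hx
  by_contra hne
  have hne' : val u x ^ p ≠ val v x ^ p := fun hcon =>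
    hne (Real.rpow_left_injOn hp0.ne' e1.le e2.le hcon)
  have e5 := (hs x hx).2 (mem_Ici.2 (by positivity : 0 ≤ val u x ^ p))
    (mem_Ici.2 (by positivity : 0 ≤ val v x ^ p)) hne'
    (by norm_num : (0 : ℝ) < 1 - 1 / 2) (by norm_num : (0 : ℝ) < 1 / 2) (by ring)
  simp only [smul_eq_mul] at e5
  rw [← Real.rpow_mul e1.le, ← Real.rpow_mul e2.le, mul_one_div_cancel hp0.ne', Real.rpow_one,
    Real.rpow_one] at e5
  rw [e3, pMean] at e4
  linarith

theorem posCrit_subset_structure (hN : 1 ≤ N) (ho : IsOpen Ω) (hconn : IsConnected Ω)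
    (hb : Bornology.IsBounded Ω) (hh : CondH1 h) (h2 : CondH2 Ω p g) (h3 : CondH3 Ω p g)
    {A' : Set (W0 N Ω p)} (hA : A' ⊆ posCrit Ω p h g) (h4 : CondH4On A') (hne : A'.Nonempty) :
    (∀ u ∈ A', ∀ v ∈ A', energy h g u = energy h g v) ∧
      ((StrictMonoOn h (Ici 0) ∨ StrictH3 Ω p g) → ∃ u₀, A' = {u₀}) ∧
      ((∀ s, 0 < s → 0 < h s) →
        ∃ u₀ ∈ A', A' ⊆ {u | ∃ α : ℝ, 0 < α ∧ u = α • u₀}) := by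
  have hΩ := ho.measurableSet
  obtain ⟨u₀, hu₀⟩ := hne
  refine ⟨fun u hu v hv => energy_eq_of_mem_posCrit hΩ hh h2 h3 (hA hu) (hA hv)
    (h4.comparable u hu v hv), fun hs => ⟨u₀, ?_⟩, fun hpos => ⟨u₀, hu₀, fun u hu => ?_⟩⟩
  · refine eq_singleton_iff_unique_mem.2 ⟨hu₀, fun u hu => ?_⟩
    rcases hs with hs | hs
    · exact eq_of_strictMonoOn hN hΩ hb hh h2 h3 hs (hA hu) (hA hu₀) (h4.comparable u hu u₀ hu₀)
    · exact eq_of_strictH3 hΩ hb hh h2 h3 hs (hA hu) (hA hu₀) (h4.comparable u hu u₀ hu₀)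
  · obtain ⟨d, hd, h5, h6⟩ := (h4.comparable u hu u₀ hu₀).exists_le
    exact exists_eq_smul_of_log_grad_eq ho hconn hb (hA hu).2 (hA hu₀).2 (h4.regular u hu)
      (h4.regular u₀ hu₀) hd h5 h6
      (log_grad_eq_of_mem_posCrit hΩ hh h2 h3 hpos (hA hu) (hA hu₀) (h4.comparable u hu u₀ hu₀))

end Main

end

end GenPLaplacian

theorem theorem4p1 {N : ℕ} (hN : 1 ≤ N) (Ω : Set (EuclideanSpace ℝ (Fin N)))
    (hΩ_open : IsOpen Ω) (hΩ_conn : IsConnected Ω) (hΩ_bdd : Bornology.IsBounded Ω)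
    (p : ℝ) [Fact (1 < p)] (h : ℝ → ℝ) (g : EuclideanSpace ℝ (Fin N) → ℝ → ℝ)
    (h1 : CondH1 h) (h2 : CondH2 Ω p g) (h3 : CondH3 Ω p g) :
    (CondH4 Ω p h g → (posCrit Ω p h g).Nonempty →
      (∀ u ∈ posCrit Ω p h g, ∀ v ∈ posCrit Ω p h g, energy h g u = energy h g v) ∧
      ((StrictMonoOn h (Ici 0) ∨ StrictH3 Ω p g) → ∃ u₀, posCrit Ω p h g = {u₀}) ∧
      ((∀ s, 0 < s → 0 < h s) →
        ∃ u₀ ∈ posCrit Ω p h g, posCrit Ω p h g ⊆ {u | ∃ α : ℝ, 0 < α ∧ u = α • u₀})) ∧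
    (∀ A' : Set (W0 N Ω p), A' ⊆ posCrit Ω p h g → CondH4On A' → A'.Nonempty →
      (∀ u ∈ A', ∀ v ∈ A', energy h g u = energy h g v) ∧
      ((StrictMonoOn h (Ici 0) ∨ StrictH3 Ω p g) → ∃ u₀, A' = {u₀}) ∧
      ((∀ s, 0 < s → 0 < h s) →
        ∃ u₀ ∈ A', A' ⊆ {u | ∃ α : ℝ, 0 < α ∧ u = α • u₀})) := by
  have key := fun (A' : Set (W0 N Ω p)) hA h4 hne =>
    posCrit_subset_structure hN hΩ_open hΩ_conn hΩ_bdd h1 h2 h3 (A' := A') hA h4 hne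
  -- (H4) is the restricted assumption for the full set of positive critical points, since these are
  -- nonnegative.
  refine ⟨fun h4 hne => key _ Subset.rfl ⟨fun u hu => h4.regular u hu.1 ?_, h4.comparable⟩ hne,
    key⟩
  exact hu.2.1.mono fun x hx => hx.le
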